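/- Let $\mathbb H$ be a separable real Hilbert space with its Borel $\sigma$-field (for instance $\mathbb H=L^2([0,1],\mathbb R)$), let $Q$ be a Borel probability measure on $\mathbb H$ with $\int_{\mathbb H}\|f\|^4\,Q(\mathrm df)<\infty$, and let $L^2_Q$ be the Hilbert space of ($Q$-classes of) measurable functions $\mathbb H\to\mathbb R$ that are square integrable with respect to $Q$. Let $X_1,X_2,\ldots$ be i.i.d. copies of a random element $X$ of $\mathbb H$ with $\mathbb E\|X\|^4<\infty$. Put $\mu=\mathbb E X$ and $Y=X-\mu$ (so $Y=X$ if $X$ is centred), let $\mathcal C f=\mathbb E(\langle X-\mu,f\rangle X)$ be the covariance operator of $X$ (and of $Y$), and $\sigma_f^2=\langle \mathcal C f,f\rangle$. With $$\overline X_n=\frac1n\sum_{j=1}^nX_j,\qquad \mathcal C_nf=\frac1n\sum_{j=1}^n\langle X_j-\overline X_n,f\rangle\,(X_j-\overline X_n),$$ define, for $f\in\mathbb H$, $$V_n(f)=\frac1{\sqrt n}\sum_{j=1}^n\Big\{\cos\langle f,X_j-\overline X_n\rangle+\sin\langle f,X_j-\overline X_n\rangle-\exp\big(-\tfrac12\langle\mathcal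 C_nf,f\rangle\big)\Big\},\qquad V_n^\star(f)=\frac{V_n(f)}{\sqrt n},$$ $$z(f)=\mathbb E\cos\langle f,Y\rangle+\mathbb E\sin\langle f,Y\rangle-\exp\big(-\tfrac12\sigma_f^2\big),$$ and, for $f,x\in\mathbb H$, $$\begin{aligned}\xi(f,x)={}&\cos\langle f,x\rangle-\mathbb E\cos\langle f,Y\rangle+\sin\langle f,x\rangle-\mathbb E\sin\langle f,Y\rangle\\&+\langle f,x\rangle\,\mathbb E\big[\sin\langle f,Y\rangle-\cos\langle f,Y\rangle\big]+\tfrac12e^{-\sigma_f^2/2}\big(\langle f,x\rangle^2-\sigma_f^2\big).\end{aligned}$$ Then the functions $\sqrt n\,(V_n^\star-z)$ define random elements of $L^2_Q$, and there is a centred Gaussian random element $\mathcal V^\star$ of $L^2_Q$ with covariance kernel $$K^\star(f,g)=\mathbb E[\xi(f,Y)\,\xi(g,Y)],\qquad f,g\in\mathbb H,$$ that is, $\mathbb E[\langle\mathcal V^\star,\Phi\rangle_Q\langle\mathcal V^\star,\Psi\rangle_Q]=\iint K^\star(f,g)\,\Phi(f)\,\Psi(g)\,Q(\mathrm df)\,Q(\mathrm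 dg)$ for all $\Phi,\Psi\in L^2_Q$, such that $$\sqrt n\,(V_n^\star-z)\ \longrightarrow\ \mathcal V^\star\quad\text{in distribution in }L^2_Q\text{ as }n\to\infty .$$ -/

import Mathlib

open MeasureTheory ProbabilityTheory Filter
open scoped RealInnerProductSpace

universe u v


noncomputable section

/-- The Hilbert space `L²_Q` of (classes of) real functions on `H`, square integrable under `Q`. -/
abbrev L2Q {H : Type*} [MeasurableSpace H] (Q : Measure H) : Type _ := Lp ℝ 2 Q

/-- `L²_Q` carries its Borel `σ`-algebra. -/
instance instMeasurableSpaceL2Q {H : Type*} [MeasurableSpace H] (Q : Measure H) :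
    MeasurableSpace (L2Q Q) := borel _

instance instBorelSpaceL2Q {H : Type*} [MeasurableSpace H] (Q : Measure H) :
    BorelSpace (L2Q Q) := ⟨rfl⟩

section Sample

variable {H : Type*} [NormedAddCommGroup H] [InnerProductSpace ℝ H]

/-- The sample mean of the first `n` members of the sequence `x`. -/
def sampleMean (n : ℕ) (x : ℕ → H) : H :=
  (n : ℝ)⁻¹ • ∑ j ∈ Finset.range n, x j

/-- The sample covariance operator (with divisor `n`) of the first `n` members of `x`; in
`L²([0,1])` it is the integral operator whose kernel is the sample covariance function. -/
def sampleCov (n : ℕ) (x : ℕ → H) (f : H) : H :=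
  (n : ℝ)⁻¹ • ∑ j ∈ Finset.range n, ⟪x j - sampleMean n x, f⟫ • (x j - sampleMean n x)

/-- The function `V_n` on `H`, evaluated at the data `x 0, …, x (n - 1)`. -/
def Vn (n : ℕ) (x : ℕ → H) (f : H) : ℝ :=
  (1 / √(n : ℝ)) * ∑ j ∈ Finset.range n,
    (Real.cos ⟪f, x j - sampleMean n x⟫ + Real.sin ⟪f, x j - sampleMean n x⟫
      - Real.exp (-(1 / 2) * ⟪sampleCov n x f, f⟫))

/-- `V_n^⋆ = V_n / √n`. -/
def VnStar (n : ℕ) (x : ℕ → H) (f : H) : ℝ :=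
  Vn n x f / √(n : ℝ)

end Sample

section Population

variable {Ω : Type*} [MeasurableSpace Ω]
  {H : Type*} [NormedAddCommGroup H] [InnerProductSpace ℝ H]

/-- The covariance operator `f ↦ E(⟨X - E X, f⟩ X)` of the random element `X`. -/
def covOp (P : Measure Ω) (X : Ω → H) (f : H) : H :=
  ∫ ω, ⟪X ω - ∫ ω', X ω' ∂P, f⟫ • X ω ∂P

/-- `σ_f² = ⟨C f, f⟩`, with `C` the covariance operator of `X`. -/
def sigmaSq (P : Measure Ω) (X : Ω → H) (f : H) : ℝ :=
  ⟪covOp P X f, f⟫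

/-- `z(f) = E cos⟨f, X⟩ + E sin⟨f, X⟩ - exp(-σ_f² / 2)`. -/
def zFun (P : Measure Ω) (X : Ω → H) (f : H) : ℝ :=
  (∫ ω, Real.cos ⟪f, X ω⟫ ∂P) + (∫ ω, Real.sin ⟪f, X ω⟫ ∂P)
    - Real.exp (-(1 / 2) * sigmaSq P X f)

/-- The linearization `ξ(f, x)`. -/
def xiFun (P : Measure Ω) (X : Ω → H) (f x : H) : ℝ :=
  Real.cos ⟪f, x⟫ - (∫ ω, Real.cos ⟪f, X ω⟫ ∂P)
    + Real.sin ⟪f, x⟫ - (∫ ω, Real.sin ⟪f, X ω⟫ ∂P)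
    + ⟪f, x⟫ * (∫ ω, (Real.sin ⟪f, X ω⟫ - Real.cos ⟪f, X ω⟫) ∂P)
    + (1 / 2) * Real.exp (-(1 / 2) * sigmaSq P X f) * (⟪f, x⟫ ^ 2 - sigmaSq P X f)

/-- The kernel `K^⋆(f, g) = E[ξ(f, X) ξ(g, X)]`. -/
def kernelStar (P : Measure Ω) (X : Ω → H) (f g : H) : ℝ :=
  ∫ ω, xiFun P X f (X ω) * xiFun P X g (X ω) ∂P

end Population

/-- `V` is a centred Gaussian random element of `L²_Q` with covariance kernel `K`. Members of
`L²_Q` are classes of functions, so that the kernel is read through the covariance operator: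
`E[⟨V, Φ⟩ ⟨V, Ψ⟩] = ∬ K(f, g) Φ(f) Ψ(g) Q(df) Q(dg)` for all `Φ`, `Ψ` in `L²_Q`. -/
structure IsCentredGaussianWithKernel {H : Type*} [MeasurableSpace H] (Q : Measure H)
    {Ω : Type*} [MeasurableSpace Ω] (P : Measure Ω) (V : Ω → L2Q Q) (K : H → H → ℝ) : Prop where
  gaussian : HasGaussianLaw V P
  centred : ∫ ω, V ω ∂P = 0
  integrable_inner : ∀ Φ Ψ : L2Q Q, Integrable (fun ω => ⟪V ω, Φ⟫ * ⟪V ω, Ψ⟫) P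
  integrable_kernel : ∀ Φ Ψ : L2Q Q,
    Integrable (fun p : H × H => K p.1 p.2 * Φ p.1 * Ψ p.2) (Q.prod Q)
  covariance : ∀ Φ Ψ : L2Q Q,
    ∫ ω, ⟪V ω, Φ⟫ * ⟪V ω, Ψ⟫ ∂P = ∫ p : H × H, K p.1 p.2 * Φ p.1 * Ψ p.2 ∂(Q.prod Q)

end
/-!
With `n` observations, `V_n^⋆ - z` is the sample mean of `ξ(f, ·)` plus a remainder, which the
addition formulas and a Taylor expansion of the exponential bound by three products: the square of
the sample mean; the sample mean times the deviation of the mean of `sin ⟨f, ·⟩ - cos ⟨f, ·⟩`; and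
the deviation of the empirical second moment times the minimum of `1` and a multiple of itself.
That last deviation is a mean of centred i.i.d. vectors `x ⊗ x - E(Y ⊗ Y)` of a Hilbert space, so in
every product the first factor is `O(n^(-1/2))` in mean square, uniformly in `f` up to a power of
`‖f‖`, while the second tends to `0` in mean square for each `f` and is dominated in `f`. By
Cauchy–Schwarz and dominated convergence, `√n` times the remainder tends to `0` in `L¹(P; L²_Q)`.
Truncating at `1` is what makes the fourth moment of `Q` enough: the untruncated square of the
second-moment deviation would call for the eighth.

The means of `ξ`, times `√n`, obey the central limit theorem in `L²_Q`: their characteristic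
functions converge by the real central limit theorem, and they are tight because a functional with
compact sublevel sets, `‖x‖²` plus a divergently weighted sum of squared distances to growing
finite-dimensional subspaces, has expectation bounded by that of a single summand.
-/


section ScaledMean

variable {Ω E F : Type*} [NormedAddCommGroup E] [InnerProductSpace ℝ E]
  [NormedAddCommGroup F] [InnerProductSpace ℝ F]

/-- The sample mean of `ζ` rescaled by `√n`, that is `(ζ 0 + ⋯ + ζ (n - 1)) / √n`: the
normalization of the central limit theorem. -/
noncomputable def scaledMean (ζ : ℕ → Ω → E) (n : ℕ) (ω : Ω) : E :=
  √(n : ℝ) • sampleMean n (ζ · ω)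

theorem scaledMean_eq (ζ : ℕ → Ω → E) (n : ℕ) (ω : Ω) :
    scaledMean ζ n ω = (√(n : ℝ))⁻¹ • ∑ j ∈ Finset.range n, ζ j ω := by
  rw [scaledMean, sampleMean, smul_smul, ← div_eq_mul_inv, Real.sqrt_div_self]

theorem scaledMean_map (L : E →L[ℝ] F) (ζ : ℕ → Ω → E) (n : ℕ) (ω : Ω) :
    scaledMean (fun j ω => L (ζ j ω)) n ω = L (scaledMean ζ n ω) := by
  simp [scaledMean, sampleMean]

end ScaledMean

section SecondMoments

open scoped ENNReal

variable {Ω : Type*} [MeasurableSpace Ω] {P : Measure Ω}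
  {E : Type*} [NormedAddCommGroup E]

theorem sq_eLpNorm_two (f : Ω → E) : eLpNorm f 2 P ^ 2 = ∫⁻ ω, ‖f ω‖ₑ ^ 2 ∂P := by
  simpa using eLpNorm_nnreal_pow_eq_lintegral (f := f) (μ := P) (p := 2) two_ne_zero

theorem lintegral_enorm_sq_ne_top {f : Ω → E} (hf : MemLp f 2 P) :
    ∫⁻ ω, ‖f ω‖ₑ ^ 2 ∂P ≠ ∞ :=
  sq_eLpNorm_two (P := P) f ▸ ENNReal.pow_ne_top hf.eLpNorm_ne_top

theorem ofReal_integral_norm_sq {f : Ω → E} (hf : MemLp f 2 P) :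
    ENNReal.ofReal (∫ ω, ‖f ω‖ ^ 2 ∂P) = ∫⁻ ω, ‖f ω‖ₑ ^ 2 ∂P := by
  rw [ofReal_integral_eq_lintegral_ofReal (hf.integrable_norm_pow two_ne_zero)
    (.of_forall fun ω => by positivity)]
  simp [ENNReal.ofReal_pow]

theorem memLp_natCast_of_integrable_norm_pow {f : Ω → E} {k : ℕ} (hf : AEStronglyMeasurable f P)
    (hk : k ≠ 0) (hint : Integrable (fun ω => ‖f ω‖ ^ k) P) : MemLp f k P := by
  refine (integrable_norm_rpow_iff hf (by simpa using hk) (by simp)).1 ?_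
  simpa using hint

theorem memLp_norm_sq {f : Ω → E} (hf : MemLp f 4 P) : MemLp (fun ω => ‖f ω‖ ^ 2) 2 P := by
  refine (memLp_two_iff_integrable_sq (hf.1.norm.pow 2)).2 ?_
  simpa only [Pi.pow_apply, ← pow_mul] using hf.integrable_norm_pow four_ne_zero

theorem memLp_one_add_norm_sq [IsFiniteMeasure P] {f : Ω → E} (hf : MemLp f 4 P) :
    MemLp (fun ω => 1 + ‖f ω‖ ^ 2) 2 P :=
  (memLp_const (1 : ℝ)).add (memLp_norm_sq hf)

variable [InnerProductSpace ℝ E]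

theorem integrable_inner_of_memLp_two {f g : Ω → E} (hf : MemLp f 2 P) (hg : MemLp g 2 P) :
    Integrable (fun ω => ⟪f ω, g ω⟫) P :=
  (hf.norm.integrable_mul hg.norm).mono' (hf.1.inner hg.1)
    (.of_forall fun ω => by simpa using abs_real_inner_le_norm (f ω) (g ω))

variable [IsProbabilityMeasure P] [CompleteSpace E] [MeasurableSpace E] [BorelSpace E]
  {ζ : ℕ → Ω → E} {ζ₀ : Ω → E}

theorem integral_norm_sum_sq (hindep : Pairwise fun i j => ζ i ⟂ᵢ[P] ζ j)
    (hident : ∀ j, IdentDistrib (ζ j) ζ₀ P P) (h2 : MemLp ζ₀ 2 P) (h0 : ∫ ω, ζ₀ ω ∂P = 0)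
    (n : ℕ) :
    ∫ ω, ‖∑ j ∈ Finset.range n, ζ j ω‖ ^ 2 ∂P = n * ∫ ω, ‖ζ₀ ω‖ ^ 2 ∂P := by
  have hm (j : ℕ) : MemLp (ζ j) 2 P := (hident j).memLp_iff.2 h2
  have hi (i j : ℕ) : Integrable (fun ω => ⟪ζ i ω, ζ j ω⟫) P :=
    integrable_inner_of_memLp_two (hm i) (hm j)
  have hcross (i j : ℕ) (hij : i ≠ j) : ∫ ω, ⟪ζ i ω, ζ j ω⟫ ∂P = 0 := by
    have h := (hindep hij).integral_bilin ((hm i).integrable one_le_two)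
      ((hm j).integrable one_le_two) (innerSL ℝ)
    rwa [(hident i).integral_eq, h0, map_zero] at h
  have hdiag (i : ℕ) : ∫ ω, ⟪ζ i ω, ζ i ω⟫ ∂P = ∫ ω, ‖ζ₀ ω‖ ^ 2 ∂P := by
    simp_rw [real_inner_self_eq_norm_sq]
    exact ((hident i).comp (u := fun x => ‖x‖ ^ 2) (by fun_prop)).integral_eq
  calc ∫ ω, ‖∑ j ∈ Finset.range n, ζ j ω‖ ^ 2 ∂P
      = ∑ i ∈ Finset.range n, ∑ j ∈ Finset.range n, ∫ ω, ⟪ζ i ω, ζ j ω⟫ ∂P := by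
        simp_rw [← real_inner_self_eq_norm_sq (∑ j ∈ Finset.range n, ζ j _), sum_inner, inner_sum]
        rw [integral_finsetSum _ fun i _ => integrable_finsetSum _ fun j _ => hi i j]
        exact Finset.sum_congr rfl fun i _ => integral_finsetSum _ fun j _ => hi i j
    _ = ∑ i ∈ Finset.range n, ∫ ω, ‖ζ₀ ω‖ ^ 2 ∂P := by
        refine Finset.sum_congr rfl fun i hin => ?_
        rw [Finset.sum_eq_single_of_mem i hin fun j _ hj => hcross i j hj.symm, hdiag]
    _ = n * ∫ ω, ‖ζ₀ ω‖ ^ 2 ∂P := by simp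

theorem lintegral_enorm_sampleMean_sq_le (hindep : Pairwise fun i j => ζ i ⟂ᵢ[P] ζ j)
    (hident : ∀ j, IdentDistrib (ζ j) ζ₀ P P) (h2 : MemLp ζ₀ 2 P) (h0 : ∫ ω, ζ₀ ω ∂P = 0)
    (n : ℕ) :
    ∫⁻ ω, ‖sampleMean n (ζ · ω)‖ₑ ^ 2 ∂P ≤ (∫⁻ ω, ‖ζ₀ ω‖ₑ ^ 2 ∂P) / n := by
  rcases n.eq_zero_or_pos with rfl | hn
  · simp [sampleMean]
  have hmean : MemLp (fun ω => sampleMean n (ζ · ω)) 2 P :=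
    (memLp_finsetSum _ fun j _ => (hident j).memLp_iff.2 h2).const_smul _
  have hn' : (n : ℝ) ≠ 0 := by positivity
  rw [← ofReal_integral_norm_sq hmean, ← ofReal_integral_norm_sq h2, ← ENNReal.ofReal_natCast n,
    ← ENNReal.ofReal_div_of_pos (by positivity)]
  simp only [sampleMean, norm_smul, mul_pow, integral_const_mul,
    integral_norm_sum_sq hindep hident h2 h0, norm_inv, Real.norm_natCast]
  refine (congrArg ENNReal.ofReal ?_).le
  field_simp

theorem lintegral_enorm_scaledMean_sq_le (hindep : Pairwise fun i j => ζ i ⟂ᵢ[P] ζ j)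
    (hident : ∀ j, IdentDistrib (ζ j) ζ₀ P P) (h2 : MemLp ζ₀ 2 P) (h0 : ∫ ω, ζ₀ ω ∂P = 0)
    (n : ℕ) :
    ∫⁻ ω, ‖scaledMean ζ n ω‖ₑ ^ 2 ∂P ≤ ∫⁻ ω, ‖ζ₀ ω‖ₑ ^ 2 ∂P := by
  have hsq : ‖√(n : ℝ)‖ₑ ^ 2 = n := by
    rw [← enorm_pow, Real.sq_sqrt n.cast_nonneg, Real.enorm_natCast]
  simp_rw [scaledMean, enorm_smul, mul_pow, hsq]
  rw [lintegral_const_mul' _ _ (by finiteness)]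
  grw [lintegral_enorm_sampleMean_sq_le hindep hident h2 h0 n]
  exact ENNReal.mul_div_le

end SecondMoments

section Tightness

open scoped Topology ENNReal NNReal

theorem isTightMeasureSet_of_lintegral_le {T : Type*} [TopologicalSpace T] [MeasurableSpace T]
    {S : Set (Measure T)} {Φ : T → ℝ≥0∞} {M : ℝ≥0∞} (hΦ : Measurable Φ) (hM : M ≠ ∞)
    (hcompact : ∀ R : ℝ≥0, IsCompact {x | Φ x ≤ R}) (hbound : ∀ μ ∈ S, ∫⁻ x, Φ x ∂μ ≤ M) :
    IsTightMeasureSet S := by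
  rw [isTightMeasureSet_iff_exists_isCompact_measure_compl_le]
  intro ε hε
  obtain ⟨R, hR₀, hR⟩ : ∃ R : ℝ≥0, 0 < R ∧ M / R < ε := by
    obtain ⟨R, hR₀, hR⟩ := ENNReal.exists_nnreal_pos_mul_lt hM hε.ne'
    exact ⟨R⁻¹, inv_pos.2 hR₀, by
      rwa [ENNReal.coe_inv hR₀.ne', ENNReal.div_eq_inv_mul, inv_inv]⟩
  refine ⟨_, hcompact R, fun μ hμ => ?_⟩
  calc μ {x | Φ x ≤ R}ᶜ ≤ μ {x | R ≤ Φ x} :=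
        measure_mono fun x hx => (lt_of_not_ge (by simpa using hx)).le
    _ ≤ (∫⁻ x, Φ x ∂μ) / R :=
        meas_ge_le_lintegral_div hΦ.aemeasurable (by simpa using hR₀.ne') ENNReal.coe_ne_top
    _ ≤ M / R := by gcongr; exact hbound μ hμ
    _ ≤ ε := hR.le

variable {E : Type*} [NormedAddCommGroup E] [InnerProductSpace ℝ E]

/-- A functional with compact sublevel sets on a Hilbert space: the squared norm plus a divergently
weighted sum of the squared distances to the subspaces `U k`. Measures under which it has bounded
integral are therefore tight. -/
noncomputable def coerciveSum (U : ℕ → Submodule ℝ E) [∀ k, FiniteDimensional ℝ (U k)] (x : E) :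
    ℝ≥0∞ :=
  ‖x‖ₑ ^ 2 + ∑' k, 2 ^ k * ‖x - (U k).starProjection x‖ₑ ^ 2

theorem continuous_sub_starProjection (V : Submodule ℝ E) [FiniteDimensional ℝ V] :
    Continuous fun x => x - V.starProjection x := by
  fun_prop

theorem totallyBounded_of_near_finiteDimensional {K : Set E} (hK : Bornology.IsBounded K)
    (hnear : ∀ ε > 0, ∃ V : Submodule ℝ E, ∃ _ : FiniteDimensional ℝ V,
      ∀ x ∈ K, ‖x - V.starProjection x‖ < ε) :
    TotallyBounded K := by
  rw [Metric.totallyBounded_iff]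
  intro ε hε
  obtain ⟨V, _, hV⟩ := hnear (ε / 2) (half_pos hε)
  have himage : TotallyBounded (V.starProjection '' K) := by
    have hbdd : Bornology.IsBounded (V.orthogonalProjectionOnto '' K) :=
      V.orthogonalProjectionOnto.lipschitz.isBounded_image hK
    have h := (hbdd.isCompact_closure.totallyBounded.subset subset_closure).image
      V.subtypeL.uniformContinuous
    rwa [Set.image_image] at h
  obtain ⟨t, ht, hcover⟩ := Metric.totallyBounded_iff.1 himage (ε / 2) (half_pos hε)
  refine ⟨t, ht, fun x hx => ?_⟩
  obtain ⟨y, hy, hxy⟩ := Set.mem_iUnion₂.1 (hcover (Set.mem_image_of_mem _ hx))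
  refine Set.mem_iUnion₂.2 ⟨y, hy, ?_⟩
  calc dist x y ≤ dist x (V.starProjection x) + dist (V.starProjection x) y := dist_triangle ..
    _ < ε / 2 + ε / 2 := add_lt_add (dist_eq_norm x _ ▸ hV x hx) hxy
    _ = ε := add_halves ε

theorem lowerSemicontinuous_coerciveSum (U : ℕ → Submodule ℝ E)
    [∀ k, FiniteDimensional ℝ (U k)] : LowerSemicontinuous (coerciveSum U) := by
  refine LowerSemicontinuous.add
    ((ENNReal.continuous_pow 2).comp continuous_enorm).lowerSemicontinuous
    (lowerSemicontinuous_tsum fun k => Continuous.lowerSemicontinuous ?_)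
  exact (ENNReal.continuous_const_mul (by finiteness)).comp
    ((ENNReal.continuous_pow 2).comp (continuous_sub_starProjection (U k)).enorm)

theorem isCompact_coerciveSum_le [CompleteSpace E] (U : ℕ → Submodule ℝ E)
    [∀ k, FiniteDimensional ℝ (U k)] (R : ℝ≥0) : IsCompact {x | coerciveSum U x ≤ R} := by
  refine TotallyBounded.isCompact_of_isClosed (totallyBounded_of_near_finiteDimensional ?_ ?_)
    ((lowerSemicontinuous_coerciveSum U).isClosed_preimage R)
  · refine isBounded_iff_forall_norm_le.2 ⟨√R, fun x hx => Real.le_sqrt_of_sq_le ?_⟩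
    have h : ‖x‖ₑ ^ 2 ≤ R := le_self_add.trans hx
    rw [enorm_eq_nnnorm] at h
    exact_mod_cast h
  · intro ε hε
    obtain ⟨k, hk⟩ := (((tendsto_pow_atTop_atTop_of_one_lt one_lt_two).atTop_mul_const
      (sq_pos_of_pos hε)).eventually_gt_atTop (R : ℝ)).exists
    refine ⟨U k, inferInstance, fun x hx => ?_⟩
    have h : 2 ^ k * ‖x - (U k).starProjection x‖ₑ ^ 2 ≤ R :=
      (ENNReal.le_tsum k).trans (le_add_self.trans hx)
    have h' : 2 ^ k * ‖x - (U k).starProjection x‖ ^ 2 ≤ R := by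
      rw [enorm_eq_nnnorm] at h
      exact_mod_cast h
    refine lt_of_pow_lt_pow_left₀ 2 hε.le (lt_of_mul_lt_mul_left (h'.trans_lt hk) (by positivity))

variable {Ω : Type*} [MeasurableSpace Ω] {P : Measure Ω}

theorem lintegral_coerciveSum (U : ℕ → Submodule ℝ E) [∀ k, FiniteDimensional ℝ (U k)]
    {f : Ω → E} (hf : AEStronglyMeasurable f P) :
    ∫⁻ ω, coerciveSum U (f ω) ∂P = ∫⁻ ω, ‖f ω‖ₑ ^ 2 ∂P
      + ∑' k, 2 ^ k * ∫⁻ ω, ‖f ω - (U k).starProjection (f ω)‖ₑ ^ 2 ∂P := by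
  have hproj (k : ℕ) : AEMeasurable (fun ω => ‖f ω - (U k).starProjection (f ω)‖ₑ ^ 2) P :=
    ((continuous_sub_starProjection (U k)).comp_aestronglyMeasurable hf).enorm.pow_const 2
  simp only [coerciveSum]
  rw [lintegral_add_left' (hf.enorm.pow_const 2), lintegral_tsum fun k => (hproj k).const_mul _]
  simp_rw [lintegral_const_mul' _ _ (ENNReal.pow_ne_top ENNReal.ofNat_ne_top)]

theorem exists_finiteDimensional_tendsto_starProjection (E : Type*) [NormedAddCommGroup E]
    [InnerProductSpace ℝ E] [SecondCountableTopology E] :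
    ∃ U : ℕ → Submodule ℝ E, ∃ _ : ∀ k, FiniteDimensional ℝ (U k),
      ∀ x, Tendsto (fun k => (U k).starProjection x) atTop (𝓝 x) := by
  let U : ℕ → Submodule ℝ E := fun k =>
    Submodule.span ℝ (TopologicalSpace.denseSeq E '' Set.Iio k)
  have hfin (k : ℕ) : FiniteDimensional ℝ (U k) :=
    FiniteDimensional.span_of_finite ℝ ((Set.finite_Iio k).image _)
  have hmono : Monotone U := fun i j hij =>
    Submodule.span_mono (Set.image_mono (Set.Iio_subset_Iio hij))
  have hdense : Set.range (TopologicalSpace.denseSeq E) ⊆ (⨆ k, U k : Submodule ℝ E) := by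
    rintro _ ⟨k, rfl⟩
    exact le_iSup U (k + 1) (Submodule.subset_span ⟨k, by simp, rfl⟩)
  exact ⟨U, hfin, fun x => Submodule.starProjection_tendsto_self U hmono x fun y _ =>
    closure_mono hdense (TopologicalSpace.denseRange_denseSeq E y)⟩

theorem tendsto_lintegral_sub_starProjection {f : Ω → E} (hf : MemLp f 2 P)
    {U : ℕ → Submodule ℝ E} [∀ k, FiniteDimensional ℝ (U k)]
    (hU : ∀ x, Tendsto (fun k => (U k).starProjection x) atTop (𝓝 x)) :
    Tendsto (fun k => ∫⁻ ω, ‖f ω - (U k).starProjection (f ω)‖ₑ ^ 2 ∂P) atTop (𝓝 0) := by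
  rw [← lintegral_zero (μ := P)]
  refine tendsto_lintegral_of_dominated_convergence' (fun ω => ‖f ω‖ₑ ^ 2) (fun k => ?_)
    (fun k => .of_forall fun ω => ?_) (lintegral_enorm_sq_ne_top hf) (.of_forall fun ω => ?_)
  · exact ((continuous_sub_starProjection (U k)).comp_aestronglyMeasurable hf.1).enorm.pow_const 2
  · dsimp only
    rw [← Submodule.starProjection_orthogonal_val]
    gcongr
    exact enorm_le_iff_norm_le.2 (Submodule.norm_starProjection_apply_le _ _)
  · have h : Tendsto (fun k => ‖f ω - (U k).starProjection (f ω)‖ₑ) atTop (𝓝 0) := by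
      simpa using ((tendsto_const_nhds (x := f ω)).sub (hU (f ω))).enorm
    simpa using ENNReal.Tendsto.pow (n := 2) h

theorem exists_lintegral_coerciveSum_ne_top [SecondCountableTopology E] {f : Ω → E}
    (hf : MemLp f 2 P) :
    ∃ U : ℕ → Submodule ℝ E, ∃ _ : ∀ k, FiniteDimensional ℝ (U k),
      ∫⁻ ω, coerciveSum U (f ω) ∂P ≠ ∞ := by
  obtain ⟨U, _, hU⟩ := exists_finiteDimensional_tendsto_starProjection E
  have hsmall (k : ℕ) :
      ∃ i, ∫⁻ ω, ‖f ω - (U i).starProjection (f ω)‖ₑ ^ 2 ∂P ≤ 4⁻¹ ^ k :=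
    ((tendsto_lintegral_sub_starProjection hf hU).eventually_le_const
      (ENNReal.pow_pos (by simp) k)).exists
  choose i hi using hsmall
  refine ⟨fun k => U (i k), inferInstance, ?_⟩
  rw [lintegral_coerciveSum _ hf.1]
  refine ENNReal.add_ne_top.2 ⟨lintegral_enorm_sq_ne_top hf, ne_top_of_le_ne_top
    ENNReal.ofNat_ne_top (b := 2) ?_⟩
  calc ∑' k, 2 ^ k * ∫⁻ ω, ‖f ω - (U (i k)).starProjection (f ω)‖ₑ ^ 2 ∂P
      ≤ ∑' k, (2 : ℝ≥0∞) ^ k * 4⁻¹ ^ k := by gcongr with k; exact hi k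
    _ = ∑' k, (2⁻¹ : ℝ≥0∞) ^ k := by
        have h : (2 : ℝ≥0∞) * 4⁻¹ = 2⁻¹ := by
          rw [show (4 : ℝ≥0∞) = 2 * 2 by norm_num, ENNReal.mul_inv (by simp) (by simp), ← mul_assoc,
            ENNReal.mul_inv_cancel (by simp) (by simp), one_mul]
        simp_rw [← mul_pow, h]
    _ = 2 := by rw [ENNReal.tsum_geometric, ENNReal.one_sub_inv_two, inv_inv]

end Tightness

section CentralLimit

open scoped Topology ENNReal

variable {Ω : Type*} [MeasurableSpace Ω] {P : Measure Ω}
  {E : Type*} [NormedAddCommGroup E] [InnerProductSpace ℝ E]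
  [MeasurableSpace E] [BorelSpace E] {ζ : ℕ → Ω → E} {ζ₀ : Ω → E}

theorem memLp_scaledMean (hident : ∀ j, IdentDistrib (ζ j) ζ₀ P P) (h2 : MemLp ζ₀ 2 P) (n : ℕ) :
    MemLp (scaledMean ζ n) 2 P :=
  ((memLp_finsetSum _ fun j _ => (hident j).memLp_iff.2 h2).const_smul _).const_smul _

theorem covarianceBilin_map_of_integral_eq_zero [IsFiniteMeasure P] [CompleteSpace E]
    [SecondCountableTopology E] (h2 : MemLp ζ₀ 2 P) (h0 : ∫ ω, ζ₀ ω ∂P = 0) (x y : E) :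
    covarianceBilin (P.map ζ₀) x y = ∫ ω, ⟪ζ₀ ω, x⟫ * ⟪ζ₀ ω, y⟫ ∂P := by
  have hmeas : AEMeasurable ζ₀ P := h2.1.aemeasurable
  have hmean : ∫ z, z ∂(P.map ζ₀) = 0 := by rw [integral_map hmeas (by fun_prop), h0]
  rw [covarianceBilin_apply ((memLp_map_measure_iff (by fun_prop) hmeas).2 h2)]
  simp only [id_eq, hmean, sub_zero, real_inner_comm _ x, real_inner_comm _ y]
  rw [integral_map hmeas (by fun_prop)]

variable [IsProbabilityMeasure P] [CompleteSpace E]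

theorem lintegral_coerciveSum_scaledMean_le (hindep : Pairwise fun i j => ζ i ⟂ᵢ[P] ζ j)
    (hident : ∀ j, IdentDistrib (ζ j) ζ₀ P P) (h2 : MemLp ζ₀ 2 P) (h0 : ∫ ω, ζ₀ ω ∂P = 0)
    (U : ℕ → Submodule ℝ E) [∀ k, FiniteDimensional ℝ (U k)] (n : ℕ) :
    ∫⁻ ω, coerciveSum U (scaledMean ζ n ω) ∂P ≤ ∫⁻ ω, coerciveSum U (ζ₀ ω) ∂P := by
  rw [lintegral_coerciveSum U (memLp_scaledMean hident h2 n).1, lintegral_coerciveSum U h2.1]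
  gcongr ?_ + ∑' k, _ * ?_ with k
  · exact lintegral_enorm_scaledMean_sq_le hindep hident h2 h0 n
  · let L : E →L[ℝ] E := ContinuousLinearMap.id ℝ E - (U k).starProjection
    have hL0 : ∫ ω, L (ζ₀ ω) ∂P = 0 := by
      rw [L.integral_comp_comm (h2.integrable one_le_two), h0, map_zero]
    have h := lintegral_enorm_scaledMean_sq_le
      (fun _ _ hij => (hindep hij).comp L.measurable L.measurable)
      (fun j => (hident j).comp L.measurable) (L.comp_memLp' h2) hL0 n
    simp only [Function.comp_def, scaledMean_map] at h
    exact h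

variable [SecondCountableTopology E]

theorem isTightMeasureSet_scaledMean (hindep : Pairwise fun i j => ζ i ⟂ᵢ[P] ζ j)
    (hident : ∀ j, IdentDistrib (ζ j) ζ₀ P P) (h2 : MemLp ζ₀ 2 P) (h0 : ∫ ω, ζ₀ ω ∂P = 0) :
    IsTightMeasureSet (Set.range fun n => P.map (scaledMean ζ n)) := by
  obtain ⟨U, _, hU⟩ := exists_lintegral_coerciveSum_ne_top h2
  have hΦ : Measurable (coerciveSum U) := (lowerSemicontinuous_coerciveSum U).measurable
  refine isTightMeasureSet_of_lintegral_le hΦ hU (isCompact_coerciveSum_le U) ?_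
  rintro _ ⟨n, rfl⟩
  rw [lintegral_map' hΦ.aemeasurable (memLp_scaledMean hident h2 n).1.aemeasurable]
  exact lintegral_coerciveSum_scaledMean_le hindep hident h2 h0 U n

theorem exists_tendsto_of_tendsto_charFun {ν : ℕ → ProbabilityMeasure E} {φ : E → ℂ}
    (htight : IsTightMeasureSet (Set.range fun n => (ν n : Measure E)))
    (hφ : ∀ t, Tendsto (fun n => charFun (ν n : Measure E) t) atTop (𝓝 (φ t))) :
    ∃ μ : ProbabilityMeasure E, Tendsto ν atTop (𝓝 μ) ∧ charFun (μ : Measure E) = φ := by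
  have hcompact : IsCompact (closure (Set.range ν)) :=
    isCompact_closure_of_isTightMeasureSet (by simpa [Set.range] using htight)
  have hcont (t : E) : Continuous fun μ : ProbabilityMeasure E => charFun (μ : Measure E) t := by
    simp_rw [charFun_eq_integral_innerProbChar]
    refine continuous_iff_continuousAt.2 fun μ => ?_
    exact (ProbabilityMeasure.tendsto_iff_forall_integral_rclike_tendsto ℂ).1 tendsto_id _
  have hcluster {μ : ProbabilityMeasure E} (hμ : MapClusterPt μ atTop ν) :
      charFun (μ : Measure E) = φ :=
    funext fun t => eq_of_nhds_neBot
      (ClusterPt.mono (hμ.tendsto_comp ((hcont t).tendsto μ)) (hφ t))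
  have hmem : ∀ᶠ n in atTop, ν n ∈ closure (Set.range ν) :=
    .of_forall fun n => subset_closure ⟨n, rfl⟩
  obtain ⟨μ, -, hμ⟩ := hcompact.exists_mapClusterPt (tendsto_principal.2 hmem)
  refine ⟨μ, hcompact.tendsto_nhds_of_unique_mapClusterPt hmem fun μ' _ hμ' => ?_, hcluster hμ⟩
  have h : (μ' : Measure E) = μ :=
    Measure.ext_of_charFun ((hcluster hμ').trans (hcluster hμ).symm)
  exact Subtype.ext h

theorem tendsto_charFun_map_scaledMean (hindep : iIndepFun ζ P)
    (hident : ∀ j, IdentDistrib (ζ j) ζ₀ P P) (h2 : MemLp ζ₀ 2 P) (h0 : ∫ ω, ζ₀ ω ∂P = 0) (t : E) :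
    Tendsto (fun n => charFun (P.map (scaledMean ζ n)) t) atTop
      (𝓝 (Complex.exp (⟪t, (0 : E)⟫ * Complex.I - covarianceBilin (P.map ζ₀) t t / 2))) := by
  have hid (j : ℕ) : IdentDistrib (fun ω => ⟪t, ζ j ω⟫) (fun ω => ⟪t, ζ₀ ω⟫) P P :=
    (hident j).comp (u := fun x => ⟪t, x⟫) (by fun_prop)
  have hmean : ∫ ω, ⟪t, ζ 0 ω⟫ ∂P = 0 := by
    rw [(hid 0).integral_eq, integral_inner (h2.integrable one_le_two), h0, inner_zero_right]
  have hvar : Var[fun ω => ⟪t, ζ 0 ω⟫; P] = covarianceBilin (P.map ζ₀) t t := by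
    have h2' : MemLp id 2 (P.map ζ₀) :=
      (memLp_map_measure_iff (by fun_prop) (hident 0).aemeasurable_snd).2 h2
    have := Measure.isProbabilityMeasure_map (hident 0).aemeasurable_snd
    rw [covarianceBilin_self h2', variance_map (by fun_prop) (hident 0).aemeasurable_snd]
    exact (hid 0).variance_eq
  have hclt := tendstoInDistribution_inv_sqrt_mul_sum_sub (P := P)
    (X := fun j ω => ⟪t, ζ j ω⟫) (Y := id)
    (P' := gaussianReal 0 (Var[fun ω => ⟪t, ζ 0 ω⟫; P]).toNNReal) .id
    (((hident 0).memLp_iff.2 h2).const_inner t)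
    (hindep.comp (fun _ x => ⟪t, x⟫) fun _ => by fun_prop)
    (fun j => (hid j).trans (hid 0).symm)
  have h := ProbabilityMeasure.tendsto_iff_tendsto_charFun.1 hclt.tendsto 1
  simp only [ProbabilityMeasure.coe_mk, Measure.map_id, charFun_gaussianReal, hvar,
    Real.coe_toNNReal _ (covarianceBilin_self_nonneg t)] at h
  convert h using 2 with n
  · rw [charFun_apply, charFun_apply, integral_map (hclt.forall_aemeasurable n) (by fun_prop),
      integral_map (memLp_scaledMean hident h2 n).1.aemeasurable (by fun_prop)]
    congr 1 with ω
    simp [scaledMean_eq, real_inner_comm t, inner_smul_right, inner_sum, hmean]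
  · simp

theorem exists_isGaussian_tendstoInDistribution_scaledMean (hindep : iIndepFun ζ P)
    (hident : ∀ j, IdentDistrib (ζ j) ζ₀ P P) (h2 : MemLp ζ₀ 2 P) (h0 : ∫ ω, ζ₀ ω ∂P = 0) :
    ∃ μ : ProbabilityMeasure E, IsGaussian (μ : Measure E) ∧ ∫ x, x ∂(μ : Measure E) = 0 ∧
      covarianceBilin (μ : Measure E) = covarianceBilin (P.map ζ₀) ∧
      TendstoInDistribution (scaledMean ζ) atTop id (fun _ => P) (μ : Measure E) := by
  have hmeas (n : ℕ) := (memLp_scaledMean hident h2 n).1.aemeasurable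
  let ν (n : ℕ) : ProbabilityMeasure E :=
    ⟨P.map (scaledMean ζ n), Measure.isProbabilityMeasure_map (hmeas n)⟩
  obtain ⟨μ, hlim, hchar⟩ := exists_tendsto_of_tendsto_charFun (ν := ν)
    (isTightMeasureSet_scaledMean (fun _ _ hij => hindep.indepFun hij) hident h2 h0)
    (tendsto_charFun_map_scaledMean hindep hident h2 h0)
  obtain ⟨hmean, hcov⟩ := gaussian_charFun_congr (0 : E) _ isPosSemidef_covarianceBilin
    (congrFun hchar)
  refine ⟨μ, isGaussian_iff_gaussian_charFun.2 ⟨0, _, isPosSemidef_covarianceBilin,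
    congrFun hchar⟩, hmean.symm, hcov.symm, hmeas, aemeasurable_id, ?_⟩
  convert! hlim
  exact congrArg 𝓝 (Subtype.ext Measure.map_id)

end CentralLimit

section RandomFields

open scoped ENNReal

theorem measurable_of_measurable_dist {S X : Type*} [MeasurableSpace S] [PseudoMetricSpace X]
    [SecondCountableTopology X] [MeasurableSpace X] [BorelSpace X] {g : S → X}
    (h : ∀ c, Measurable fun s => dist (g s) c) : Measurable g := by
  refine measurable_of_isOpen fun U hU => ?_
  let balls : Set (X × ℝ) := {p | Metric.ball p.1 p.2 ⊆ U}
  have hcover : ⋃ p ∈ balls, Metric.ball p.1 p.2 = U := by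
    refine Set.Subset.antisymm (Set.iUnion₂_subset fun p hp => hp) fun x hx => ?_
    obtain ⟨ε, hε, hball⟩ := Metric.isOpen_iff.1 hU x hx
    exact Set.mem_iUnion₂.2 ⟨(x, ε), hball, Metric.mem_ball_self hε⟩
  obtain ⟨T, -, hT, hTU⟩ := TopologicalSpace.isOpen_biUnion_countable balls
    (fun p => Metric.ball p.1 p.2) fun _ _ => Metric.isOpen_ball
  rw [← hcover, ← hTU, Set.preimage_iUnion₂]
  exact .biUnion hT fun p _ => measurableSet_lt (h p.1) measurable_const

theorem memLp_two_mul_prod {S T : Type*} [MeasurableSpace S] [MeasurableSpace T] {μ : Measure S}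
    {ν : Measure T} [SFinite ν] {u : S → ℝ} {v : T → ℝ} (hu : MemLp u 2 μ) (hv : MemLp v 2 ν) :
    MemLp (fun p : S × T => u p.1 * v p.2) 2 (μ.prod ν) := by
  refine (memLp_two_iff_integrable_sq (hu.1.comp_fst.mul hv.1.comp_snd)).2 ?_
  simpa only [Pi.mul_apply, mul_pow] using hu.integrable_sq.mul_prod hv.integrable_sq

variable {T : Type*} [MeasurableSpace T] {Q : Measure T}

instance instSecondCountableTopologyL2Q [MeasurableSpace.CountablyGenerated T] [SFinite Q] :
    SecondCountableTopology (L2Q Q) :=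
  haveI : Fact ((2 : ℝ≥0∞) ≠ ∞) := ⟨by simp⟩
  Lp.SecondCountableTopology

section Class

variable {S : Type*} {F : S → T → ℝ}

/-- The `L²_Q`-valued map whose value at `s` is the class of `F s`: a random field with square
integrable paths, viewed as a random element of `L²_Q`. -/
noncomputable def toL2Q (hF : ∀ s, MemLp (F s) 2 Q) (s : S) : L2Q Q := (hF s).toLp (F s)

theorem inner_toL2Q (hF : ∀ s, MemLp (F s) 2 Q) (s : S) (Φ : L2Q Q) :
    ⟪toL2Q hF s, Φ⟫ = ∫ f, F s f * Φ f ∂Q := by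
  rw [L2.inner_def]
  refine integral_congr_ae ?_
  filter_upwards [(hF s).coeFn_toLp] with f hf
  rw [toL2Q, hf]
  simp [mul_comm]

theorem measurable_toL2Q [MeasurableSpace S] [SFinite Q] [SecondCountableTopology (L2Q Q)]
    (hF : ∀ s, MemLp (F s) 2 Q) (hmeas : Measurable (Function.uncurry F)) :
    Measurable (toL2Q hF) := by
  refine measurable_of_measurable_dist fun c => ?_
  have hdist (s : S) : dist (toL2Q hF s) c
      = ((∫⁻ f, ‖F s f - c f‖ₑ ^ (2 : ℝ) ∂Q) ^ (1 / 2 : ℝ)).toReal := by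
    rw [toL2Q, Lp.dist_def, eLpNorm_congr_ae (g := F s - ⇑c) ((hF s).coeFn_toLp.sub (ae_eq_refl _)),
      eLpNorm_eq_lintegral_rpow_enorm_toReal (by simp) (by simp)]
    simp
  simp_rw [hdist]
  have hc : Measurable (c : T → ℝ) := (Lp.stronglyMeasurable c).measurable
  have hsq : Measurable fun p : S × T => ‖F p.1 p.2 - c p.2‖ₑ ^ (2 : ℝ) :=
    ((hmeas.sub (hc.comp measurable_snd)).enorm).pow_const 2
  exact (hsq.lintegral_prod_right'.pow_const _).ennreal_toReal

end Class

section SecondOrder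

variable {Ω : Type*} [MeasurableSpace Ω] {P : Measure Ω} [SFinite Q] {G : Ω → T → ℝ}

theorem memLp_toL2Q (hG : ∀ ω, MemLp (G ω) 2 Q) (hmeas : AEStronglyMeasurable (toL2Q hG) P)
    (h2 : MemLp (Function.uncurry G) 2 (P.prod Q)) : MemLp (toL2Q hG) 2 P := by
  refine ⟨hmeas, ?_⟩
  have hsq : eLpNorm (toL2Q hG) 2 P ^ 2 = ∫⁻ p, ‖Function.uncurry G p‖ₑ ^ 2 ∂(P.prod Q) := by
    rw [sq_eLpNorm_two, lintegral_prod _ (h2.1.enorm.pow_const 2)]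
    simp_rw [toL2Q, Lp.enorm_toLp, sq_eLpNorm_two, Function.uncurry]
  exact ENNReal.pow_lt_top_iff.1 (hsq ▸ (lintegral_enorm_sq_ne_top h2).lt_top) |>.resolve_right
    two_ne_zero

theorem integrable_mul_mul_prod [SFinite P] (h2 : MemLp (Function.uncurry G) 2 (P.prod Q))
    (Φ Ψ : L2Q Q) :
    Integrable (fun p : Ω × T × T => G p.1 p.2.1 * G p.1 p.2.2 * Φ p.2.1 * Ψ p.2.2)
      (P.prod (Q.prod Q)) := by
  have hmul (Θ : L2Q Q) :
      MemLp (fun p : Ω × T × T => G p.1 p.2.1 * Θ p.2.2) 2 (P.prod (Q.prod Q)) :=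
    (memLp_two_mul_prod h2 (Lp.memLp Θ)).comp_measurePreserving
      (measurePreserving_prodAssoc P Q Q).symm
  have hswap : MemLp (fun p : Ω × T × T => G p.1 p.2.2 * Φ p.2.1) 2 (P.prod (Q.prod Q)) :=
    (hmul Φ).comp_measurePreserving ((MeasurePreserving.id P).prod Measure.measurePreserving_swap)
  refine ((hmul Ψ).integrable_mul hswap).congr (.of_forall fun p => ?_)
  simp only [Pi.mul_apply]
  ring

theorem integral_toL2Q_eq_zero [IsFiniteMeasure P] (hG : ∀ ω, MemLp (G ω) 2 Q)
    (hmeas : AEStronglyMeasurable (toL2Q hG) P)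
    (h2 : MemLp (Function.uncurry G) 2 (P.prod Q)) (h0 : ∀ f, ∫ ω, G ω f ∂P = 0) :
    ∫ ω, toL2Q hG ω ∂P = 0 := by
  refine ext_inner_left ℝ fun Φ => ?_
  have hint : Integrable (fun p : Ω × T => G p.1 p.2 * Φ p.2) (P.prod Q) :=
    h2.integrable_mul ((Lp.memLp Φ).comp_snd P)
  rw [inner_zero_right, ← integral_inner ((memLp_toL2Q hG hmeas h2).integrable one_le_two)]
  simp_rw [real_inner_comm _ Φ, inner_toL2Q]
  rw [integral_integral_swap hint]
  simp_rw [integral_mul_const, h0, zero_mul, integral_zero]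

theorem integrable_integral_mul_mul [SFinite P] (h2 : MemLp (Function.uncurry G) 2 (P.prod Q))
    (Φ Ψ : L2Q Q) :
    Integrable (fun p : T × T => (∫ ω, G ω p.1 * G ω p.2 ∂P) * Φ p.1 * Ψ p.2) (Q.prod Q) := by
  simp_rw [← integral_mul_const]
  exact (integrable_mul_mul_prod h2 Φ Ψ).integral_prod_right

theorem integral_inner_toL2Q_mul [SFinite P] (hG : ∀ ω, MemLp (G ω) 2 Q)
    (h2 : MemLp (Function.uncurry G) 2 (P.prod Q)) (Φ Ψ : L2Q Q) :
    ∫ ω, ⟪toL2Q hG ω, Φ⟫ * ⟪toL2Q hG ω, Ψ⟫ ∂P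
      = ∫ p : T × T, (∫ ω, G ω p.1 * G ω p.2 ∂P) * Φ p.1 * Ψ p.2 ∂(Q.prod Q) := by
  simp_rw [inner_toL2Q, ← integral_prod_mul, ← integral_mul_const]
  rw [integral_integral_swap]
  · congr 1 with p
    congr 1 with ω
    ring
  · refine (integrable_mul_mul_prod h2 Φ Ψ).congr (.of_forall fun p => ?_)
    simp only [Function.uncurry]
    ring

end SecondOrder

end RandomFields

section SampleMean

variable {E F : Type*} [NormedAddCommGroup E] [InnerProductSpace ℝ E] [NormedAddCommGroup F]
  [InnerProductSpace ℝ F]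

theorem sampleMean_map (L : E →ₗ[ℝ] F) (n : ℕ) (y : ℕ → E) :
    sampleMean n (fun j => L (y j)) = L (sampleMean n y) := by
  simp only [sampleMean, map_smul, map_sum]

theorem sampleMean_add (n : ℕ) (x y : ℕ → E) :
    sampleMean n (fun j => x j + y j) = sampleMean n x + sampleMean n y := by
  rw [sampleMean, Finset.sum_add_distrib, smul_add, sampleMean, sampleMean]

theorem sampleMean_sub (n : ℕ) (x y : ℕ → E) :
    sampleMean n (fun j => x j - y j) = sampleMean n x - sampleMean n y := by
  rw [sampleMean, Finset.sum_sub_distrib, smul_sub, sampleMean, sampleMean]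

theorem sampleMean_const {n : ℕ} (hn : n ≠ 0) (c : E) : sampleMean n (fun _ => c) = c := by
  have hn' : (n : ℝ) ≠ 0 := by exact_mod_cast hn
  rw [sampleMean, Finset.sum_const, Finset.card_range, ← Nat.cast_smul_eq_nsmul ℝ, smul_smul,
    inv_mul_cancel₀ hn', one_smul]

theorem sampleMean_sub_const {n : ℕ} (hn : n ≠ 0) (x : ℕ → E) (c : E) :
    sampleMean n (fun j => x j - c) = sampleMean n x - c := by
  rw [sampleMean_sub, sampleMean_const hn]

theorem sampleMean_mul_left (a : ℝ) (n : ℕ) (x : ℕ → ℝ) :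
    sampleMean n (fun j => a * x j) = a * sampleMean n x :=
  sampleMean_map (LinearMap.mulLeft ℝ a) n x

theorem inner_sampleMean (f : E) (n : ℕ) (y : ℕ → E) :
    ⟪f, sampleMean n y⟫ = sampleMean n fun j => ⟪f, y j⟫ :=
  (sampleMean_map (innerₗ E f) n y).symm

theorem norm_sampleMean_le {n : ℕ} {y : ℕ → E} {C : ℝ} (hC : 0 ≤ C) (hy : ∀ j, ‖y j‖ ≤ C) :
    ‖sampleMean n y‖ ≤ C := by
  rw [sampleMean, norm_smul, norm_inv, Real.norm_natCast]
  calc (n : ℝ)⁻¹ * ‖∑ j ∈ Finset.range n, y j‖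
      ≤ (n : ℝ)⁻¹ * (n * C) := by
        gcongr
        simpa using norm_sum_le_of_le (Finset.range n) fun j _ => hy j
    _ ≤ C := by
        rw [← mul_assoc]
        exact mul_le_of_le_one_left hC inv_mul_le_one

theorem aestronglyMeasurable_sampleMean {S : Type*} [MeasurableSpace S] {μ : Measure S}
    {g : ℕ → S → E} (hg : ∀ j, AEStronglyMeasurable (g j) μ) (n : ℕ) :
    AEStronglyMeasurable (fun s => sampleMean n (g · s)) μ :=
  (Finset.aestronglyMeasurable_fun_sum _ fun j _ => hg j).const_smul _

end SampleMean

section ElementaryInequalities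

theorem exp_neg_mul_sub_le (u v : ℝ) :
    Real.exp (-u) * (u - v) ≤ Real.exp (-v) - Real.exp (-u) := by
  have h : Real.exp (-v) = Real.exp (-u) * Real.exp (u - v) := by rw [← Real.exp_add]; ring_nf
  nlinarith [Real.add_one_le_exp (u - v), Real.exp_pos (-u)]

theorem abs_exp_neg_sub_exp_neg_le {u v : ℝ} (hu : 0 ≤ u) (hv : 0 ≤ v) :
    |Real.exp (-u) - Real.exp (-v)| ≤ min 1 |u - v| := by
  wlog huv : u ≤ v generalizing u v
  · rw [abs_sub_comm, abs_sub_comm u]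
    exact this hv hu (le_of_not_ge huv)
  have hu1 : Real.exp (-u) ≤ 1 := Real.exp_le_one_iff.2 (neg_nonpos.2 hu)
  have hmono : Real.exp (-v) ≤ Real.exp (-u) := Real.exp_le_exp.2 (neg_le_neg huv)
  rw [abs_of_nonneg (sub_nonneg.2 hmono), abs_of_nonpos (sub_nonpos.2 huv)]
  refine le_min (by linarith [Real.exp_pos (-v)]) ?_
  nlinarith [exp_neg_mul_sub_le u v]

-- The remainder lies between `0` and `(e⁻ᵛ - e⁻ᵘ) (u - v)`, by the tangents at `v` and at `u`.
theorem abs_exp_neg_sub_taylor_le {u v : ℝ} (hu : 0 ≤ u) (hv : 0 ≤ v) :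
    |Real.exp (-u) - Real.exp (-v) + Real.exp (-v) * (u - v)| ≤ |u - v| * min 1 |u - v| := by
  have hu' := exp_neg_mul_sub_le u v
  have hv' := exp_neg_mul_sub_le v u
  rw [abs_of_nonneg (by linarith)]
  calc Real.exp (-u) - Real.exp (-v) + Real.exp (-v) * (u - v)
      ≤ (u - v) * (Real.exp (-v) - Real.exp (-u)) := by linarith
    _ ≤ |u - v| * |Real.exp (-v) - Real.exp (-u)| := (le_abs_self _).trans_eq (abs_mul _ _)
    _ ≤ |u - v| * min 1 |u - v| := by
        gcongr
        rw [abs_sub_comm]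
        exact abs_exp_neg_sub_exp_neg_le hu hv

theorem abs_sin_sub_le_sq (b : ℝ) : |Real.sin b - b| ≤ b ^ 2 := by
  rw [← sq_abs b]
  rcases le_total |b| 2 with h | h
  · rw [abs_sub_comm]
    nlinarith [Real.abs_sub_sin_le b, abs_nonneg b, sq_nonneg |b|]
  · have hsin : |Real.sin b| ≤ |b| := Real.abs_sin_le_abs
    nlinarith [abs_sub (Real.sin b) b]

theorem abs_cos_sub_one_le (b : ℝ) : |Real.cos b - 1| ≤ b ^ 2 / 2 := by
  rw [abs_le]
  constructor <;> linarith [Real.one_sub_sq_div_two_le_cos (x := b), Real.cos_le_one b, sq_nonneg b]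

/-- To be read with `w` an empirical second moment, `b` an empirical mean and `v` the variance. -/
theorem abs_exp_neg_half_sub_taylor_le {b v w : ℝ} (hv : 0 ≤ v) (hwb : b ^ 2 ≤ w) :
    |Real.exp (-(1 / 2) * (w - b ^ 2)) - Real.exp (-(1 / 2) * v)
        + 1 / 2 * Real.exp (-(1 / 2) * v) * (w - v)|
      ≤ b ^ 2 + |w - v| * min 1 |w - v| := by
  have hw : 0 ≤ w := (sq_nonneg b).trans hwb
  have hshift := abs_exp_neg_sub_exp_neg_le (u := 1 / 2 * (w - b ^ 2)) (v := 1 / 2 * w)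
    (by linarith) (by linarith)
  have htaylor := abs_exp_neg_sub_taylor_le (u := 1 / 2 * w) (v := 1 / 2 * v)
    (by linarith) (by linarith)
  have hb : |1 / 2 * (w - b ^ 2) - 1 / 2 * w| ≤ b ^ 2 := by
    rw [abs_of_nonpos (by nlinarith)]
    linarith [sq_nonneg b]
  have hhalf : |1 / 2 * w - 1 / 2 * v| ≤ |w - v| := by
    rw [← mul_sub, abs_mul, abs_of_pos one_half_pos]
    linarith [abs_nonneg (w - v)]
  simp only [neg_mul]
  calc _ = |(Real.exp (-(1 / 2 * (w - b ^ 2))) - Real.exp (-(1 / 2 * w)))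
        + (Real.exp (-(1 / 2 * w)) - Real.exp (-(1 / 2 * v))
          + Real.exp (-(1 / 2 * v)) * (1 / 2 * w - 1 / 2 * v))| := by congr 1; ring
    _ ≤ _ := (abs_add_le _ _).trans (add_le_add hshift htaylor)
    _ ≤ b ^ 2 + |w - v| * min 1 |w - v| := by
        gcongr
        exact (min_le_right _ _).trans hb

end ElementaryInequalities

section Statistic

variable {H : Type*} [NormedAddCommGroup H] [InnerProductSpace ℝ H]

theorem inner_sampleCov_eq_sampleMean (n : ℕ) (y : ℕ → H) (f : H) :
    ⟪sampleCov n y f, f⟫ = sampleMean n fun j => (⟪f, y j⟫ - ⟪f, sampleMean n y⟫) ^ 2 := by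
  have hcov : sampleCov n y f
      = sampleMean n fun j => ⟪y j - sampleMean n y, f⟫ • (y j - sampleMean n y) := rfl
  rw [hcov, real_inner_comm, inner_sampleMean]
  congr 1 with j
  rw [real_inner_smul_right, real_inner_comm, inner_sub_right, sq]

theorem inner_sampleCov_nonneg (n : ℕ) (y : ℕ → H) (f : H) : 0 ≤ ⟪sampleCov n y f, f⟫ := by
  rw [inner_sampleCov_eq_sampleMean, sampleMean, smul_eq_mul]
  positivity

theorem inner_sampleCov {n : ℕ} (hn : n ≠ 0) (y : ℕ → H) (f : H) :
    ⟪sampleCov n y f, f⟫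
      = sampleMean n (fun j => ⟪f, y j⟫ ^ 2) - ⟪f, sampleMean n y⟫ ^ 2 := by
  have hsq (j : ℕ) : (⟪f, y j⟫ - ⟪f, sampleMean n y⟫) ^ 2 = ⟪f, y j⟫ ^ 2
      + (-2 * ⟪f, sampleMean n y⟫) * ⟪f, y j⟫ + ⟪f, sampleMean n y⟫ ^ 2 := by ring
  rw [inner_sampleCov_eq_sampleMean]
  simp_rw [hsq, sampleMean_add, sampleMean_mul_left, sampleMean_const hn, ← inner_sampleMean]
  ring

theorem VnStar_eq {n : ℕ} (hn : n ≠ 0) (y : ℕ → H) (f : H) :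
    VnStar n y f = sampleMean n (fun j => Real.cos ⟪f, y j - sampleMean n y⟫)
      + sampleMean n (fun j => Real.sin ⟪f, y j - sampleMean n y⟫)
      - Real.exp (-(1 / 2) * ⟪sampleCov n y f, f⟫) := by
  have hroot : (1 / √(n : ℝ)) / √(n : ℝ) = (n : ℝ)⁻¹ := by
    rw [div_div, Real.mul_self_sqrt n.cast_nonneg, one_div]
  rw [VnStar, Vn, mul_div_right_comm, hroot, ← smul_eq_mul, ← sampleMean, sampleMean_sub_const hn,
    sampleMean_add]

theorem abs_VnStar_le (n : ℕ) (y : ℕ → H) (f : H) : |VnStar n y f| ≤ 3 := by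
  rcases eq_or_ne n 0 with rfl | hn
  · simp [VnStar]
  have hcos : |sampleMean n fun j => Real.cos ⟪f, y j - sampleMean n y⟫| ≤ 1 :=
    norm_sampleMean_le (E := ℝ) zero_le_one fun j => Real.abs_cos_le_one _
  have hsin : |sampleMean n fun j => Real.sin ⟪f, y j - sampleMean n y⟫| ≤ 1 :=
    norm_sampleMean_le (E := ℝ) zero_le_one fun j => Real.abs_sin_le_one _
  have hexp : Real.exp (-(1 / 2) * ⟪sampleCov n y f, f⟫) ≤ 1 :=
    Real.exp_le_one_iff.2 (by linarith [inner_sampleCov_nonneg n y f])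
  have hexp0 := Real.exp_pos (-(1 / 2) * ⟪sampleCov n y f, f⟫)
  rw [VnStar_eq hn]
  rw [abs_le] at hcos hsin ⊢
  constructor <;> linarith

theorem continuous_VnStar (n : ℕ) : Continuous fun p : (ℕ → H) × H => VnStar n p.1 p.2 := by
  unfold VnStar Vn sampleCov sampleMean
  fun_prop

theorem VnStar_sub_const (n : ℕ) (x : ℕ → H) (c f : H) :
    VnStar n (fun j => x j - c) f = VnStar n x f := by
  rcases eq_or_ne n 0 with rfl | hn
  · simp [VnStar]
  · simp [VnStar, Vn, sampleCov, sampleMean_sub_const hn]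

theorem VnStar_eq_of_addition_formulas {n : ℕ} (hn : n ≠ 0) (y : ℕ → H) (f : H) :
    VnStar n y f =
      Real.cos ⟪f, sampleMean n y⟫
          * (sampleMean n (fun j => Real.cos ⟪f, y j⟫) + sampleMean n (fun j => Real.sin ⟪f, y j⟫))
        + Real.sin ⟪f, sampleMean n y⟫
          * (sampleMean n (fun j => Real.sin ⟪f, y j⟫) - sampleMean n (fun j => Real.cos ⟪f, y j⟫))
        - Real.exp (-(1 / 2) * ⟪sampleCov n y f, f⟫) := by
  rw [VnStar_eq hn]
  simp_rw [inner_sub_right, Real.cos_sub, Real.sin_sub, mul_comm (Real.cos ⟪f, y _⟫),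
    mul_comm (Real.sin ⟪f, y _⟫), sub_eq_add_neg, ← neg_mul, sampleMean_add, sampleMean_mul_left]
  ring

end Statistic

section Population

variable {Ω : Type*} [MeasurableSpace Ω] {P : Measure Ω}
  {H : Type*} [NormedAddCommGroup H] [InnerProductSpace ℝ H] {Y : Ω → H}

theorem abs_integral_le_of_abs_le [IsProbabilityMeasure P] {g : Ω → ℝ} {C : ℝ}
    (hg : ∀ ω, |g ω| ≤ C) : |∫ ω, g ω ∂P| ≤ C := by
  simpa using norm_integral_le_of_norm_le_const (μ := P) (f := g) (.of_forall hg)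

theorem abs_sin_sub_cos_le_two (t : ℝ) : |Real.sin t - Real.cos t| ≤ 2 :=
  (abs_sub _ _).trans (by linarith [Real.abs_sin_le_one t, Real.abs_cos_le_one t])

theorem sigmaSq_eq [CompleteSpace H] (h2 : MemLp Y 2 P) (h0 : ∫ ω, Y ω ∂P = 0) (f : H) :
    sigmaSq P Y f = ∫ ω, ⟪f, Y ω⟫ ^ 2 ∂P := by
  have hint : Integrable (fun ω => ⟪Y ω, f⟫ • Y ω) P := by
    refine (h2.norm.integrable_sq.const_mul ‖f‖).mono'
      ((h2.1.inner aestronglyMeasurable_const).smul h2.1) (.of_forall fun ω => ?_)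
    rw [norm_smul]
    calc ‖⟪Y ω, f⟫‖ * ‖Y ω‖ ≤ ‖Y ω‖ * ‖f‖ * ‖Y ω‖ := by
          gcongr; exact abs_real_inner_le_norm _ _
      _ = ‖f‖ * ‖Y ω‖ ^ 2 := by ring
  rw [sigmaSq, covOp, h0, real_inner_comm, ← integral_inner (by simpa using hint)]
  congr 1 with ω
  rw [sub_zero, inner_smul_right, real_inner_comm, sq]

theorem sigmaSq_nonneg [CompleteSpace H] (h2 : MemLp Y 2 P) (h0 : ∫ ω, Y ω ∂P = 0) (f : H) :
    0 ≤ sigmaSq P Y f := by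
  rw [sigmaSq_eq h2 h0]
  exact integral_nonneg fun ω => sq_nonneg _

theorem inner_sq_le_norm_sq_mul_norm_sq (f x : H) : ⟪f, x⟫ ^ 2 ≤ ‖f‖ ^ 2 * ‖x‖ ^ 2 := by
  rw [← mul_pow, ← sq_abs]
  gcongr
  exact abs_real_inner_le_norm f x

theorem abs_zFun_le [CompleteSpace H] [IsProbabilityMeasure P] (h2 : MemLp Y 2 P)
    (h0 : ∫ ω, Y ω ∂P = 0) (f : H) : |zFun P Y f| ≤ 3 := by
  have hcos := abs_le.1 (abs_integral_le_of_abs_le (P := P) fun ω =>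
    Real.abs_cos_le_one ⟪f, Y ω⟫)
  have hsin := abs_le.1 (abs_integral_le_of_abs_le (P := P) fun ω =>
    Real.abs_sin_le_one ⟪f, Y ω⟫)
  have hexp : Real.exp (-(1 / 2) * sigmaSq P Y f) ≤ 1 :=
    Real.exp_le_one_iff.2 (by linarith [sigmaSq_nonneg h2 h0 f])
  rw [zFun, abs_le]
  constructor <;> linarith [Real.exp_pos (-(1 / 2) * sigmaSq P Y f)]

theorem sigmaSq_le [CompleteSpace H] (h2 : MemLp Y 2 P) (h0 : ∫ ω, Y ω ∂P = 0) (f : H) :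
    sigmaSq P Y f ≤ ‖f‖ ^ 2 * ∫ ω, ‖Y ω‖ ^ 2 ∂P := by
  rw [sigmaSq_eq h2 h0, ← integral_const_mul]
  exact integral_mono_of_nonneg (.of_forall fun ω => sq_nonneg _)
    (h2.norm.integrable_sq.const_mul _)
    (.of_forall fun ω => inner_sq_le_norm_sq_mul_norm_sq f (Y ω))

theorem abs_xiFun_le [CompleteSpace H] [IsProbabilityMeasure P] (h2 : MemLp Y 2 P)
    (h0 : ∫ ω, Y ω ∂P = 0) (f x : H) :
    |xiFun P Y f x| ≤ (5 + ∫ ω, ‖Y ω‖ ^ 2 ∂P) * ((1 + ‖f‖ ^ 2) * (1 + ‖x‖ ^ 2)) := by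
  have hcos := Real.abs_cos_le_one ⟪f, x⟫
  have hsin := Real.abs_sin_le_one ⟪f, x⟫
  have hEcos := abs_integral_le_of_abs_le (P := P) fun ω => Real.abs_cos_le_one ⟪f, Y ω⟫
  have hEsin := abs_integral_le_of_abs_le (P := P) fun ω => Real.abs_sin_le_one ⟪f, Y ω⟫
  have hlin : |⟪f, x⟫ * ∫ ω, (Real.sin ⟪f, Y ω⟫ - Real.cos ⟪f, Y ω⟫) ∂P| ≤ ‖f‖ * ‖x‖ * 2 := by
    rw [abs_mul]
    gcongr
    · exact abs_real_inner_le_norm f x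
    · exact abs_integral_le_of_abs_le fun ω => abs_sin_sub_cos_le_two _
  have hquad : |(1 / 2) * Real.exp (-(1 / 2) * sigmaSq P Y f) * (⟪f, x⟫ ^ 2 - sigmaSq P Y f)|
      ≤ 1 / 2 * 1 * (‖f‖ ^ 2 * ‖x‖ ^ 2 + ‖f‖ ^ 2 * ∫ ω, ‖Y ω‖ ^ 2 ∂P) := by
    have hσ := sigmaSq_nonneg h2 h0 f
    rw [abs_mul, abs_mul, Real.abs_exp, abs_of_pos one_half_pos]
    gcongr
    · exact Real.exp_le_one_iff.2 (by linarith)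
    · refine (abs_sub _ _).trans (add_le_add ?_ ?_)
      · rw [abs_sq]; exact inner_sq_le_norm_sq_mul_norm_sq f x
      · rw [abs_of_nonneg hσ]; exact sigmaSq_le h2 h0 f
  have hsum : |xiFun P Y f x| ≤ 4 + ‖f‖ * ‖x‖ * 2
      + 1 / 2 * 1 * (‖f‖ ^ 2 * ‖x‖ ^ 2 + ‖f‖ ^ 2 * ∫ ω, ‖Y ω‖ ^ 2 ∂P) := by
    rw [xiFun]
    rw [abs_le] at hcos hsin hEcos hEsin hlin hquad ⊢
    constructor <;> linarith
  have hm : 0 ≤ ∫ ω, ‖Y ω‖ ^ 2 ∂P := integral_nonneg fun ω => by positivity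
  nlinarith [sq_nonneg (‖f‖ - ‖x‖), sq_nonneg (‖f‖ * ‖x‖), sq_nonneg ‖f‖, sq_nonneg ‖x‖,
    mul_nonneg hm (sq_nonneg ‖f‖), mul_nonneg hm (sq_nonneg ‖x‖),
    mul_nonneg hm (sq_nonneg (‖f‖ * ‖x‖))]

end Population

section Measurability

variable {Ω : Type*} [MeasurableSpace Ω] {P : Measure Ω}
  {H : Type*} [NormedAddCommGroup H] [InnerProductSpace ℝ H] [SecondCountableTopology H]
  [MeasurableSpace H] [BorelSpace H] {Y : Ω → H}

theorem measurable_integral_comp_inner [SFinite P] (hY : AEMeasurable Y P) {φ : ℝ → ℝ}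
    (hφ : Measurable φ) : Measurable fun f => ∫ ω, φ ⟪f, Y ω⟫ ∂P := by
  have hmap (f : H) : ∫ ω, φ ⟪f, Y ω⟫ ∂P = ∫ y, φ ⟪f, y⟫ ∂(P.map Y) :=
    (integral_map hY (hφ.comp (measurable_const.inner measurable_id)).aestronglyMeasurable).symm
  have hjoint : Measurable fun p : H × H => φ ⟪p.1, p.2⟫ := hφ.comp (by fun_prop)
  simp_rw [hmap]
  exact hjoint.stronglyMeasurable.integral_prod_right.measurable

variable [CompleteSpace H]

section CentredSecondOrder

variable (h2 : MemLp Y 2 P) (h0 : ∫ ω, Y ω ∂P = 0)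
include h2 h0

theorem measurable_sigmaSq [SFinite P] : Measurable (sigmaSq P Y) := by
  rw [funext (sigmaSq_eq h2 h0)]
  exact measurable_integral_comp_inner h2.1.aemeasurable (measurable_id.pow_const 2)

theorem measurable_zFun [SFinite P] : Measurable (zFun P Y) :=
  ((measurable_integral_comp_inner h2.1.aemeasurable Real.measurable_cos).add
    (measurable_integral_comp_inner h2.1.aemeasurable Real.measurable_sin)).sub
      (Real.measurable_exp.comp ((measurable_sigmaSq h2 h0).const_mul _))

theorem measurable_uncurry_xiFun [SFinite P] : Measurable (Function.uncurry (xiFun P Y)) := by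
  have hY := h2.1.aemeasurable
  have hinner : Measurable fun p : H × H => ⟪p.1, p.2⟫ := by fun_prop
  have hfst : Measurable (Prod.fst : H × H → H) := measurable_fst
  have hcos := (measurable_integral_comp_inner hY Real.measurable_cos).comp hfst
  have hsin := (measurable_integral_comp_inner hY Real.measurable_sin).comp hfst
  have hdiff := (measurable_integral_comp_inner hY
    (Real.measurable_sin.sub Real.measurable_cos)).comp hfst
  have hσ := (measurable_sigmaSq h2 h0).comp hfst
  exact (((((Real.measurable_cos.comp hinner).sub hcos).add
    (Real.measurable_sin.comp hinner)).sub hsin).add (hinner.mul hdiff)).add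
      (((Real.measurable_exp.comp (hσ.const_mul _)).const_mul _).mul ((hinner.pow_const 2).sub hσ))

theorem integral_xiFun_eq_zero [IsProbabilityMeasure P] (f : H) :
    ∫ ω, xiFun P Y f (Y ω) ∂P = 0 := by
  have hY := h2.1.aemeasurable
  have hcos : Integrable (fun ω => Real.cos ⟪f, Y ω⟫) P :=
    .of_bound (by fun_prop) 1 (.of_forall fun ω => Real.abs_cos_le_one _)
  have hsin : Integrable (fun ω => Real.sin ⟪f, Y ω⟫) P :=
    .of_bound (by fun_prop) 1 (.of_forall fun ω => Real.abs_sin_le_one _)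
  have hinner : Integrable (fun ω => ⟪f, Y ω⟫) P := (h2.const_inner f).integrable one_le_two
  have hsq : Integrable (fun ω => ⟪f, Y ω⟫ ^ 2) P := (h2.const_inner f).integrable_sq
  have hmean : ∫ ω, ⟪f, Y ω⟫ ∂P = 0 := by
    rw [integral_inner (h2.integrable one_le_two), h0, inner_zero_right]
  simp only [xiFun]
  rw [integral_add, integral_add, integral_sub, integral_add, integral_sub, integral_mul_const,
    integral_const_mul, integral_sub, integral_sub, hmean, ← sigmaSq_eq h2 h0]
  · simp
  all_goals fun_prop

theorem memLp_xiFun [IsProbabilityMeasure P] {Q : Measure H} [IsFiniteMeasure Q]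
    (hQ : MemLp id 4 Q) (x : H) : MemLp (fun f => xiFun P Y f x) 2 Q := by
  refine MemLp.of_le_mul (c := (5 + ∫ ω, ‖Y ω‖ ^ 2 ∂P) * (1 + ‖x‖ ^ 2))
    (memLp_one_add_norm_sq hQ)
    (measurable_uncurry_xiFun h2 h0).of_uncurry_right.aestronglyMeasurable (.of_forall fun f => ?_)
  rw [Real.norm_of_nonneg (by positivity : 0 ≤ 1 + ‖id f‖ ^ 2)]
  exact (abs_xiFun_le h2 h0 f x).trans_eq (by simp only [id]; ring)

end CentredSecondOrder

theorem memLp_uncurry_xiFun [IsProbabilityMeasure P] {Q : Measure H} [IsFiniteMeasure Q]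
    (h0 : ∫ ω, Y ω ∂P = 0) (hQ : MemLp id 4 Q) (h4 : MemLp Y 4 P) :
    MemLp (Function.uncurry fun ω f => xiFun P Y f (Y ω)) 2 (P.prod Q) := by
  have h2 : MemLp Y 2 P := h4.mono_exponent (by norm_num)
  refine MemLp.of_le_mul (c := 5 + ∫ ω, ‖Y ω‖ ^ 2 ∂P)
    (memLp_two_mul_prod (memLp_one_add_norm_sq h4) (memLp_one_add_norm_sq hQ)) ?_
    (.of_forall fun p => ?_)
  · exact ((measurable_uncurry_xiFun h2 h0).comp_aemeasurable
      (measurable_snd.aemeasurable.prodMk h2.1.aemeasurable.comp_fst)).aestronglyMeasurable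
  · rw [Real.norm_of_nonneg (by positivity :
      0 ≤ (1 + ‖Y p.1‖ ^ 2) * (1 + ‖id p.2‖ ^ 2)), mul_comm (1 + ‖Y p.1‖ ^ 2)]
    exact abs_xiFun_le h2 h0 p.2 (Y p.1)

end Measurability

section Linearization

variable {Ω : Type*} [MeasurableSpace Ω] {P : Measure Ω}
  {H : Type*} [NormedAddCommGroup H] [InnerProductSpace ℝ H] {Y : Ω → H}

/-- The centred function `x ↦ sin ⟨f, x⟩ - cos ⟨f, x⟩`. Its sample mean is the error made when the
coefficient of `⟨f, x⟩` in `ξ(f, x)` is replaced by its empirical version. -/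
noncomputable def sinSubCosDeviation (P : Measure Ω) (Y : Ω → H) (f x : H) : ℝ :=
  Real.sin ⟪f, x⟫ - Real.cos ⟪f, x⟫ - ∫ ω, (Real.sin ⟪f, Y ω⟫ - Real.cos ⟪f, Y ω⟫) ∂P

theorem abs_sinSubCosDeviation_le [IsProbabilityMeasure P] (f x : H) :
    |sinSubCosDeviation P Y f x| ≤ 4 :=
  (abs_sub _ _).trans <| (add_le_add (abs_sin_sub_cos_le_two _)
    (abs_integral_le_of_abs_le fun _ => abs_sin_sub_cos_le_two _)).trans (by norm_num)

theorem enorm_sinSubCosDeviation_le [IsProbabilityMeasure P] (f x : H) :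
    ‖sinSubCosDeviation P Y f x‖ₑ ≤ 4 := by
  simpa [Real.enorm_eq_ofReal_abs] using abs_sinSubCosDeviation_le (P := P) (Y := Y) f x

theorem sampleMean_xiFun {n : ℕ} (hn : n ≠ 0) (y : ℕ → H) (f : H) :
    sampleMean n (fun j => xiFun P Y f (y j)) =
      sampleMean n (fun j => Real.cos ⟪f, y j⟫) - ∫ ω, Real.cos ⟪f, Y ω⟫ ∂P
        + (sampleMean n (fun j => Real.sin ⟪f, y j⟫) - ∫ ω, Real.sin ⟪f, Y ω⟫ ∂P)
        + ⟪f, sampleMean n y⟫ * ∫ ω, (Real.sin ⟪f, Y ω⟫ - Real.cos ⟪f, Y ω⟫) ∂P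
        + (1 / 2) * Real.exp (-(1 / 2) * sigmaSq P Y f)
          * (sampleMean n (fun j => ⟪f, y j⟫ ^ 2) - sigmaSq P Y f) := by
  simp_rw [xiFun, inner_sampleMean, mul_comm ⟪f, y _⟫, sampleMean_add, sampleMean_mul_left,
    sampleMean_sub_const hn, sampleMean_add, sampleMean_sub_const hn]
  ring

theorem sampleMean_sinSubCosDeviation {n : ℕ} (hn : n ≠ 0) (y : ℕ → H) (f : H) :
    sampleMean n (fun j => sinSubCosDeviation P Y f (y j)) =
      sampleMean n (fun j => Real.sin ⟪f, y j⟫) - sampleMean n (fun j => Real.cos ⟪f, y j⟫)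
        - ∫ ω, (Real.sin ⟪f, Y ω⟫ - Real.cos ⟪f, Y ω⟫) ∂P := by
  simp_rw [sinSubCosDeviation, sampleMean_sub_const hn, sampleMean_sub]

/-- The error made when `V_n^⋆ - z` is replaced by the sample mean of `ξ`. -/
noncomputable def linearizationRemainder (P : Measure Ω) (Y : Ω → H) (n : ℕ) (y : ℕ → H) (f : H) :
    ℝ :=
  VnStar n y f - zFun P Y f - sampleMean n fun j => xiFun P Y f (y j)

theorem abs_linearizationRemainder_le {n : ℕ} (hn : n ≠ 0) (y : ℕ → H) (f : H)
    (hσ : 0 ≤ sigmaSq P Y f) :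
    |linearizationRemainder P Y n y f| ≤
      4 * ⟪f, sampleMean n y⟫ ^ 2
        + |⟪f, sampleMean n y⟫| * |sampleMean n (fun j => sinSubCosDeviation P Y f (y j))|
        + |sampleMean n (fun j => ⟪f, y j⟫ ^ 2) - sigmaSq P Y f|
          * min 1 |sampleMean n (fun j => ⟪f, y j⟫ ^ 2) - sigmaSq P Y f| := by
  rw [linearizationRemainder, VnStar_eq_of_addition_formulas hn, sampleMean_xiFun hn, zFun,
    inner_sampleCov hn, ← abs_mul, sampleMean_sinSubCosDeviation hn]
  set b := ⟪f, sampleMean n y⟫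
  set C := sampleMean n fun j => Real.cos ⟪f, y j⟫
  set S := sampleMean n fun j => Real.sin ⟪f, y j⟫
  set w := sampleMean n fun j => ⟪f, y j⟫ ^ 2
  set v := sigmaSq P Y f
  set D := ∫ ω, (Real.sin ⟪f, Y ω⟫ - Real.cos ⟪f, Y ω⟫) ∂P
  have hC : |C| ≤ 1 := norm_sampleMean_le (E := ℝ) zero_le_one fun j => Real.abs_cos_le_one _
  have hS : |S| ≤ 1 := norm_sampleMean_le (E := ℝ) zero_le_one fun j => Real.abs_sin_le_one _
  have hbw : b ^ 2 ≤ w := by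
    have := inner_sampleCov_nonneg n y f
    rwa [inner_sampleCov hn, sub_nonneg] at this
  have hcos : |(Real.cos b - 1) * (C + S)| ≤ b ^ 2 / 2 * 2 := by
    rw [abs_mul]
    gcongr
    exacts [abs_cos_sub_one_le b, (abs_add_le _ _).trans (by linarith)]
  have hsin : |(Real.sin b - b) * (S - C)| ≤ b ^ 2 * 2 := by
    rw [abs_mul]
    gcongr
    exacts [abs_sin_sub_le_sq b, (abs_sub _ _).trans (by linarith)]
  have hexp := abs_exp_neg_half_sub_taylor_le hσ hbw
  have hlin := abs_le.1 (le_refl |b * (S - C - D)|)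
  rw [abs_le] at hcos hsin hexp ⊢
  constructor <;> linarith

end Linearization

section ProductNorms

open scoped ENNReal Topology

theorem lintegral_mul_sq_le {Ω : Type*} [MeasurableSpace Ω] {P : Measure Ω} {f g : Ω → ℝ≥0∞}
    (hf : AEMeasurable f P) (hg : AEMeasurable g P) :
    (∫⁻ ω, f ω * g ω ∂P) ^ 2 ≤ (∫⁻ ω, f ω ^ 2 ∂P) * ∫⁻ ω, g ω ^ 2 ∂P := by
  have h := ENNReal.lintegral_mul_le_Lp_mul_Lq P .two_two hf hg
  rw [← ENNReal.mul_rpow_of_nonneg _ _ (by positivity), one_div,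
    ENNReal.le_rpow_inv_iff two_pos] at h
  simpa only [ENNReal.rpow_two, Pi.mul_apply] using h

variable {Ω T F : Type*} [MeasurableSpace Ω] [MeasurableSpace T] {P : Measure Ω} {Q : Measure T}
  [SFinite Q] [NormedAddCommGroup F]

theorem aemeasurable_eLpNorm_two {B : Ω → T → F}
    (hB : AEStronglyMeasurable (Function.uncurry B) (P.prod Q)) :
    AEMeasurable (fun ω => eLpNorm (B ω) 2 Q) P := by
  have hsqrt (ω : Ω) : eLpNorm (B ω) 2 Q = (∫⁻ f, ‖B ω f‖ₑ ^ 2 ∂Q) ^ ((2 : ℕ) : ℝ)⁻¹ := by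
    rw [← sq_eLpNorm_two, ENNReal.pow_rpow_inv_natCast two_ne_zero]
  simp_rw [hsqrt]
  exact (hB.enorm.pow_const 2).lintegral_prod_right'.pow_const _

theorem lintegral_mul_eLpNorm_sq_le [SFinite P] {A : Ω → ℝ≥0∞} (hA : AEMeasurable A P)
    {B : Ω → T → F} (hB : AEStronglyMeasurable (Function.uncurry B) (P.prod Q)) :
    (∫⁻ ω, A ω * eLpNorm (B ω) 2 Q ∂P) ^ 2
      ≤ (∫⁻ ω, A ω ^ 2 ∂P) * ∫⁻ f, ∫⁻ ω, ‖B ω f‖ₑ ^ 2 ∂P ∂Q := by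
  have h := lintegral_mul_sq_le hA (aemeasurable_eLpNorm_two hB)
  simp_rw [sq_eLpNorm_two] at h
  rwa [lintegral_lintegral_swap (hB.enorm.pow_const 2)] at h

theorem tendsto_lintegral_mul_eLpNorm [SFinite P] {A : ℕ → Ω → ℝ≥0∞} {B : ℕ → Ω → T → F}
    {c : ℝ≥0∞} {b : T → ℝ≥0∞} (hA : ∀ n, AEMeasurable (A n) P) (hc : c ≠ ∞)
    (hAc : ∀ n, ∫⁻ ω, A n ω ^ 2 ∂P ≤ c)
    (hB : ∀ n, AEStronglyMeasurable (Function.uncurry (B n)) (P.prod Q))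
    (hb : ∫⁻ f, b f ∂Q ≠ ∞) (hBb : ∀ᶠ n in atTop, ∀ f, ∫⁻ ω, ‖B n ω f‖ₑ ^ 2 ∂P ≤ b f)
    (hlim : ∀ f, Tendsto (fun n => ∫⁻ ω, ‖B n ω f‖ₑ ^ 2 ∂P) atTop (𝓝 0)) :
    Tendsto (fun n => ∫⁻ ω, A n ω * eLpNorm (B n ω) 2 Q ∂P) atTop (𝓝 0) := by
  have hprod : Tendsto (fun n => ∫⁻ f, ∫⁻ ω, ‖B n ω f‖ₑ ^ 2 ∂P ∂Q) atTop (𝓝 0) := by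
    rw [← lintegral_zero (μ := Q)]
    exact tendsto_lintegral_filter_of_dominated_convergence' b
      (.of_forall fun n => (((hB n).enorm.pow_const 2).prod_swap).lintegral_prod_right')
      (hBb.mono fun n h => .of_forall h) hb (.of_forall hlim)
  have hsq : Tendsto (fun n => (∫⁻ ω, A n ω * eLpNorm (B n ω) 2 Q ∂P) ^ 2) atTop (𝓝 0) := by
    refine tendsto_of_tendsto_of_tendsto_of_le_of_le tendsto_const_nhds
      (by simpa using ENNReal.Tendsto.const_mul hprod (.inr hc)) (fun _ => zero_le) fun n => ?_
    exact (lintegral_mul_eLpNorm_sq_le (hA n) (hB n)).trans (by gcongr; exact hAc n)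
  simpa [-Nat.cast_ofNat, ENNReal.pow_rpow_inv_natCast two_ne_zero] using
    hsq.ennrpow_const ((2 : ℕ) : ℝ)⁻¹

theorem tendsto_const_div_natCast {c : ℝ≥0∞} (hc : c ≠ ∞) :
    Tendsto (fun n : ℕ => c / n) atTop (𝓝 0) := by
  simpa using ENNReal.Tendsto.const_div ENNReal.tendsto_nat_nhds_top (.inr hc)

end ProductNorms

section TensorSquare

open scoped TensorProduct
open UniformSpace (Completion)

variable {H : Type*} [NormedAddCommGroup H] [InnerProductSpace ℝ H]

/-- The square `x ⊗ x`, in the Hilbert tensor square of `H`. It turns the quadratic form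
`⟨f, x⟩ ^ 2` into a linear one, so that averages of squares become averages of vectors. -/
noncomputable def tensorSquare (x : H) : Completion (H ⊗[ℝ] H) := (x ⊗ₜ[ℝ] x : H ⊗[ℝ] H)

theorem continuous_tensorSquare : Continuous (tensorSquare : H → Completion (H ⊗[ℝ] H)) :=
  (Completion.continuous_coe _).comp
    (TensorProduct.continuous_tmul.comp (continuous_id.prodMk continuous_id))

theorem inner_tensorSquare (f x : H) : ⟪tensorSquare f, tensorSquare x⟫ = ⟪f, x⟫ ^ 2 := by
  rw [tensorSquare, tensorSquare, Completion.inner_coe, TensorProduct.inner_tmul, sq]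

theorem norm_tensorSquare (x : H) : ‖tensorSquare x‖ = ‖x‖ ^ 2 := by
  rw [tensorSquare, Completion.norm_coe, TensorProduct.norm_tmul, sq]

variable {Ω : Type*} [MeasurableSpace Ω] {P : Measure Ω} {Y : Ω → H}

theorem memLp_tensorSquare (h4 : MemLp Y 4 P) : MemLp (fun ω => tensorSquare (Y ω)) 2 P := by
  refine (memLp_norm_iff (continuous_tensorSquare.comp_aestronglyMeasurable h4.1)).1 ?_
  simpa only [Function.comp_apply, norm_tensorSquare] using memLp_norm_sq h4

/-- The centred function `x ↦ x ⊗ x`. Its sample mean is the deviation of the empirical second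
moment from the second moment of `Y`, in the Hilbert–Schmidt norm. -/
noncomputable def tensorSquareDeviation (P : Measure Ω) (Y : Ω → H) (x : H) :
    Completion (H ⊗[ℝ] H) :=
  tensorSquare x - ∫ ω, tensorSquare (Y ω) ∂P

theorem continuous_tensorSquareDeviation : Continuous (tensorSquareDeviation P Y) :=
  continuous_tensorSquare.sub continuous_const

variable [IsProbabilityMeasure P] (h4 : MemLp Y 4 P)
include h4

theorem memLp_tensorSquareDeviation : MemLp (fun ω => tensorSquareDeviation P Y (Y ω)) 2 P :=
  (memLp_tensorSquare h4).sub (memLp_const _)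

theorem integral_tensorSquareDeviation_eq_zero : ∫ ω, tensorSquareDeviation P Y (Y ω) ∂P = 0 := by
  simp only [tensorSquareDeviation]
  rw [integral_sub ((memLp_tensorSquare h4).integrable one_le_two) (integrable_const _)]
  simp

theorem inner_sampleMean_tensorSquareDeviation [CompleteSpace H] (h0 : ∫ ω, Y ω ∂P = 0) {n : ℕ}
    (hn : n ≠ 0) (y : ℕ → H) (f : H) :
    ⟪tensorSquare f, sampleMean n fun j => tensorSquareDeviation P Y (y j)⟫
      = sampleMean n (fun j => ⟪f, y j⟫ ^ 2) - sigmaSq P Y f := by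
  have h2 : MemLp Y 2 P := h4.mono_exponent (by norm_num)
  have hint := (memLp_tensorSquare h4).integrable one_le_two
  simp_rw [inner_sampleMean, tensorSquareDeviation, inner_sub_right, inner_tensorSquare,
    sampleMean_sub_const hn, ← integral_inner hint, inner_tensorSquare, sigmaSq_eq h2 h0]

end TensorSquare

section NormBound

variable {Ω : Type*} [MeasurableSpace Ω] {P : Measure Ω} [IsProbabilityMeasure P]
  {H : Type*} [NormedAddCommGroup H] [InnerProductSpace ℝ H] [CompleteSpace H] {Y : Ω → H}

theorem abs_linearizationRemainder_le_norm (h4 : MemLp Y 4 P) (h0 : ∫ ω, Y ω ∂P = 0) {n : ℕ}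
    (hn : n ≠ 0) (y : ℕ → H) (f : H) :
    |linearizationRemainder P Y n y f| ≤
      ‖sampleMean n y‖ * (4 * ‖f‖ ^ 2 * ‖sampleMean n y‖)
        + ‖sampleMean n y‖ * (‖f‖ * |sampleMean n (fun j => sinSubCosDeviation P Y f (y j))|)
        + ‖sampleMean n fun j => tensorSquareDeviation P Y (y j)‖ * (‖f‖ ^ 2
          * min 1 (‖f‖ ^ 2 * ‖sampleMean n fun j => tensorSquareDeviation P Y (y j)‖)) := by
  have hmean := abs_real_inner_le_norm f (sampleMean n y)
  have hdev := abs_real_inner_le_norm (tensorSquare f)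
    (sampleMean n fun j => tensorSquareDeviation P Y (y j))
  rw [inner_sampleMean_tensorSquareDeviation h4 h0 hn, norm_tensorSquare] at hdev
  refine (abs_linearizationRemainder_le hn y f
    (sigmaSq_nonneg (h4.mono_exponent (by norm_num)) h0 f)).trans ?_
  rw [← sq_abs ⟪f, _⟫]
  grw [hmean, min_le_min_left 1 hdev, hdev]
  exact le_of_eq (by ring)

end NormBound

section WeightedSampleMean

open scoped ENNReal Topology

variable {Ω : Type*} [MeasurableSpace Ω] {P : Measure Ω} [IsProbabilityMeasure P]
  {E : Type*} [NormedAddCommGroup E] [InnerProductSpace ℝ E] [CompleteSpace E]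
  [MeasurableSpace E] [BorelSpace E]

theorem lintegral_enorm_mul_norm_sampleMean_sq_le {ζ : ℕ → Ω → E} {ζ₀ : Ω → E}
    (hindep : Pairwise fun i j => ζ i ⟂ᵢ[P] ζ j) (hident : ∀ j, IdentDistrib (ζ j) ζ₀ P P)
    (h2 : MemLp ζ₀ 2 P) (h0 : ∫ ω, ζ₀ ω ∂P = 0) (a : ℝ) (n : ℕ) :
    ∫⁻ ω, ‖a * ‖sampleMean n (ζ · ω)‖‖ₑ ^ 2 ∂P ≤ ‖a‖ₑ ^ 2 * (∫⁻ ω, ‖ζ₀ ω‖ₑ ^ 2 ∂P) / n := by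
  simp_rw [enorm_mul, enorm_norm, mul_pow]
  rw [lintegral_const_mul' _ _ (by finiteness), mul_div_assoc]
  gcongr
  exact lintegral_enorm_sampleMean_sq_le hindep hident h2 h0 n

variable {T : Type*} [MeasurableSpace T] {Q : Measure T} [SFinite Q]

theorem tendsto_lintegral_mul_eLpNorm_mul_norm_sampleMean
    {ζ : T → ℕ → Ω → E} {ζ₀ : T → Ω → E} (hindep : ∀ f, Pairwise fun i j => ζ f i ⟂ᵢ[P] ζ f j)
    (hident : ∀ f j, IdentDistrib (ζ f j) (ζ₀ f) P P) (h2 : ∀ f, MemLp (ζ₀ f) 2 P)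
    (h0 : ∀ f, ∫ ω, ζ₀ f ω ∂P = 0)
    (hmeas : ∀ j, AEStronglyMeasurable (Function.uncurry fun ω f => ζ f j ω) (P.prod Q))
    {C : ℝ≥0∞} (hC : C ≠ ∞) (hζC : ∀ f, ∫⁻ ω, ‖ζ₀ f ω‖ₑ ^ 2 ∂P ≤ C)
    {A : ℕ → Ω → ℝ≥0∞} (hA : ∀ n, AEMeasurable (A n) P) {c : ℝ≥0∞} (hc : c ≠ ∞)
    (hAc : ∀ n, ∫⁻ ω, A n ω ^ 2 ∂P ≤ c) {u : T → ℝ} (hu : MemLp u 2 Q) :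
    Tendsto (fun n => ∫⁻ ω, A n ω * eLpNorm (fun f => u f * ‖sampleMean n (ζ f · ω)‖) 2 Q ∂P)
      atTop (𝓝 0) := by
  have hrate (n : ℕ) (f : T) :
      ∫⁻ ω, ‖u f * ‖sampleMean n (ζ f · ω)‖‖ₑ ^ 2 ∂P ≤ ‖u f‖ₑ ^ 2 * C / n := by
    grw [lintegral_enorm_mul_norm_sampleMean_sq_le (hindep f) (hident f) (h2 f) (h0 f), hζC f]
  refine tendsto_lintegral_mul_eLpNorm hA hc hAc (b := fun f => ‖u f‖ₑ ^ 2 * C) (fun n => ?_) ?_ ?_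
    fun f => ?_
  · exact hu.1.comp_snd.mul (aestronglyMeasurable_sampleMean hmeas n).norm
  · rw [lintegral_mul_const' _ _ hC]
    exact ENNReal.mul_ne_top (lintegral_enorm_sq_ne_top hu) hC
  · filter_upwards [eventually_ge_atTop 1] with n hn f
    exact (hrate n f).trans
      (ENNReal.div_le_of_le_mul (le_mul_of_one_le_right' (by exact_mod_cast hn)))
  · exact tendsto_of_tendsto_of_tendsto_of_le_of_le tendsto_const_nhds
      (tendsto_const_div_natCast (by finiteness)) (fun _ => zero_le) fun n => hrate n f

theorem tendsto_lintegral_mul_eLpNorm_mul_min_one_mul_norm_sampleMean {ζ : ℕ → Ω → E} {ζ₀ : Ω → E}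
    (hindep : Pairwise fun i j => ζ i ⟂ᵢ[P] ζ j) (hident : ∀ j, IdentDistrib (ζ j) ζ₀ P P)
    (h2 : MemLp ζ₀ 2 P) (h0 : ∫ ω, ζ₀ ω ∂P = 0) {A : ℕ → Ω → ℝ≥0∞}
    (hA : ∀ n, AEMeasurable (A n) P) {c : ℝ≥0∞} (hc : c ≠ ∞)
    (hAc : ∀ n, ∫⁻ ω, A n ω ^ 2 ∂P ≤ c) {u v : T → ℝ} (hu : MemLp u 2 Q)
    (hv : AEStronglyMeasurable v Q) (hv0 : 0 ≤ v) :
    Tendsto (fun n => ∫⁻ ω, A n ω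
      * eLpNorm (fun f => u f * min 1 (v f * ‖sampleMean n (ζ · ω)‖)) 2 Q ∂P) atTop (𝓝 0) := by
  have hmin (n : ℕ) (ω : Ω) (f : T) : 0 ≤ min 1 (v f * ‖sampleMean n (ζ · ω)‖) :=
    le_min zero_le_one (mul_nonneg (hv0 f) (norm_nonneg _))
  refine tendsto_lintegral_mul_eLpNorm hA hc hAc (b := fun f => ‖u f‖ₑ ^ 2) (fun n => ?_)
    (lintegral_enorm_sq_ne_top hu) (.of_forall fun n f => ?_) fun f => ?_
  · have hmean : AEStronglyMeasurable (fun ω => sampleMean n (ζ · ω)) P :=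
      aestronglyMeasurable_sampleMean (fun j => ((hident j).memLp_iff.2 h2).1) n
    exact hu.1.comp_snd.mul
      (aestronglyMeasurable_const.inf (hv.comp_snd.mul hmean.norm.comp_fst))
  · refine (lintegral_mono (g := fun _ => ‖u f‖ₑ ^ 2) fun ω => ?_).trans (by simp)
    refine pow_le_pow_left' (enorm_le_iff_norm_le.2 ?_) 2
    rw [norm_mul, Real.norm_of_nonneg (hmin n ω f)]
    exact mul_le_of_le_one_right (norm_nonneg _) (min_le_left _ _)
  · have hrate (n : ℕ) : ∫⁻ ω, ‖u f * min 1 (v f * ‖sampleMean n (ζ · ω)‖)‖ₑ ^ 2 ∂P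
        ≤ ‖u f * v f‖ₑ ^ 2 * (∫⁻ ω, ‖ζ₀ ω‖ₑ ^ 2 ∂P) / n := by
      refine (lintegral_mono fun ω => pow_le_pow_left' (enorm_le_iff_norm_le.2 ?_) 2).trans
        (lintegral_enorm_mul_norm_sampleMean_sq_le hindep hident h2 h0 (u f * v f) n)
      rw [mul_assoc, norm_mul, norm_mul, Real.norm_of_nonneg (hmin n ω f)]
      gcongr
      exact (min_le_right _ _).trans (le_abs_self _)
    exact tendsto_of_tendsto_of_tendsto_of_le_of_le tendsto_const_nhds
      (tendsto_const_div_natCast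
        (ENNReal.mul_ne_top (by finiteness) (lintegral_enorm_sq_ne_top h2)))
      (fun _ => zero_le) hrate

end WeightedSampleMean

section CentredSample

open scoped ENNReal Topology

variable {Ω : Type*} [MeasurableSpace Ω] {P : Measure Ω} [IsProbabilityMeasure P]
  {H : Type*} [NormedAddCommGroup H] [InnerProductSpace ℝ H]
  [SecondCountableTopology H] [MeasurableSpace H] [BorelSpace H]
  {Y : Ω → H} {Ys : ℕ → Ω → H} {Q : Measure H}

theorem measurable_uncurry_sinSubCosDeviation (hY : AEMeasurable Y P) :
    Measurable (Function.uncurry (sinSubCosDeviation P Y)) := by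
  have hinner : Measurable fun p : H × H => ⟪p.1, p.2⟫ := by fun_prop
  have hfst : Measurable (Prod.fst : H × H → H) := measurable_fst
  exact ((Real.measurable_sin.comp hinner).sub (Real.measurable_cos.comp hinner)).sub
    ((measurable_integral_comp_inner hY (Real.measurable_sin.sub Real.measurable_cos)).comp hfst)

theorem integral_sinSubCosDeviation_eq_zero (hY : AEMeasurable Y P) (f : H) :
    ∫ ω, sinSubCosDeviation P Y f (Y ω) ∂P = 0 := by
  have hint : Integrable (fun ω => Real.sin ⟪f, Y ω⟫ - Real.cos ⟪f, Y ω⟫) P :=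
    .of_bound (by fun_prop) 2 (.of_forall fun ω => abs_sin_sub_cos_le_two _)
  simp only [sinSubCosDeviation]
  rw [integral_sub hint (integrable_const _)]
  simp

theorem eLpNorm_sqrt_mul_linearizationRemainder_le [CompleteSpace H] (h4 : MemLp Y 4 P)
    (h0 : ∫ ω, Y ω ∂P = 0) (n : ℕ) (y : ℕ → H) :
    eLpNorm (fun f => √(n : ℝ) * linearizationRemainder P Y n y f) 2 Q ≤
      ‖√(n : ℝ) • sampleMean n y‖ₑ * eLpNorm (fun f => 4 * ‖f‖ ^ 2 * ‖sampleMean n y‖) 2 Q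
      + ‖√(n : ℝ) • sampleMean n y‖ₑ * eLpNorm (fun f =>
        ‖f‖ * |sampleMean n fun j => sinSubCosDeviation P Y f (y j)|) 2 Q
      + ‖√(n : ℝ) • sampleMean n fun j => tensorSquareDeviation P Y (y j)‖ₑ
        * eLpNorm (fun f => ‖f‖ ^ 2
          * min 1 (‖f‖ ^ 2 * ‖sampleMean n fun j => tensorSquareDeviation P Y (y j)‖)) 2 Q := by
  set a := ‖√(n : ℝ) • sampleMean n y‖
  set d := ‖√(n : ℝ) • sampleMean n fun j => tensorSquareDeviation P Y (y j)‖
  set B₁ : H → ℝ := fun f => 4 * ‖f‖ ^ 2 * ‖sampleMean n y‖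
  set B₂ : H → ℝ := fun f => ‖f‖ * |sampleMean n fun j => sinSubCosDeviation P Y f (y j)|
  set B₃ : H → ℝ := fun f =>
    ‖f‖ ^ 2 * min 1 (‖f‖ ^ 2 * ‖sampleMean n fun j => tensorSquareDeviation P Y (y j)‖)
  have hpoint (f : H) :
      ‖√(n : ℝ) * linearizationRemainder P Y n y f‖ ≤ (a • B₁ + a • B₂ + d • B₃) f := by
    rcases eq_or_ne n 0 with rfl | hn
    · simp [a, d]
    · rw [norm_mul, Real.norm_of_nonneg (Real.sqrt_nonneg _), Real.norm_eq_abs]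
      grw [abs_linearizationRemainder_le_norm h4 h0 hn y f]
      simp only [a, d, norm_smul, Real.norm_of_nonneg (Real.sqrt_nonneg _), Pi.add_apply,
        Pi.smul_apply, smul_eq_mul, B₁, B₂, B₃]
      exact le_of_eq (by ring)
  have hB₁ : AEStronglyMeasurable B₁ Q := by fun_prop
  have hB₂ : AEStronglyMeasurable B₂ Q := by
    have hdev (j : ℕ) : Measurable fun f => sinSubCosDeviation P Y f (y j) :=
      (measurable_uncurry_sinSubCosDeviation h4.1.aemeasurable).of_uncurry_right
    exact continuous_norm.aestronglyMeasurable.mul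
      (aestronglyMeasurable_sampleMean (fun j => (hdev j).aestronglyMeasurable) n).norm
  have hB₃ : AEStronglyMeasurable B₃ Q := by fun_prop
  rw [← enorm_norm, ← enorm_norm (√(n : ℝ) • sampleMean n fun j => _)]
  grw [eLpNorm_mono_real hpoint,
    eLpNorm_add_le ((hB₁.const_smul a).add (hB₂.const_smul a)) (hB₃.const_smul d) one_le_two,
    eLpNorm_add_le (hB₁.const_smul a) (hB₂.const_smul a) one_le_two]
  simp_rw [eLpNorm_const_smul]
  exact le_rfl

variable [IsFiniteMeasure Q] (hindep : Pairwise fun i j => Ys i ⟂ᵢ[P] Ys j)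
  (hident : ∀ j, IdentDistrib (Ys j) Y P P) (h4 : MemLp Y 4 P) (hQ : MemLp id 4 Q)
include hindep hident h4 hQ

theorem tendsto_lintegral_scaledMean_mul_eLpNorm_tensorSquareDeviation :
    Tendsto (fun n => ∫⁻ ω, ‖scaledMean (fun j ω => tensorSquareDeviation P Y (Ys j ω)) n ω‖ₑ
      * eLpNorm (fun f : H => ‖f‖ ^ 2
        * min 1 (‖f‖ ^ 2 * ‖sampleMean n fun j => tensorSquareDeviation P Y (Ys j ω)‖)) 2 Q ∂P)
      atTop (𝓝 0) := by
  borelize (UniformSpace.Completion (TensorProduct ℝ H H))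
  have hT : Measurable (tensorSquareDeviation P Y) := continuous_tensorSquareDeviation.measurable
  have hTident (j : ℕ) : IdentDistrib (fun ω => tensorSquareDeviation P Y (Ys j ω))
      (fun ω => tensorSquareDeviation P Y (Y ω)) P P := (hident j).comp hT
  have hTindep : Pairwise fun i j => (fun ω => tensorSquareDeviation P Y (Ys i ω)) ⟂ᵢ[P]
      fun ω => tensorSquareDeviation P Y (Ys j ω) := fun i j hij => (hindep hij).comp hT hT
  have hT2 := memLp_tensorSquareDeviation h4
  have hT0 := integral_tensorSquareDeviation_eq_zero h4
  exact tendsto_lintegral_mul_eLpNorm_mul_min_one_mul_norm_sampleMean hTindep hTident hT2 hT0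
    (fun n => (memLp_scaledMean hTident hT2 n).1.enorm) (lintegral_enorm_sq_ne_top hT2)
    (lintegral_enorm_scaledMean_sq_le hTindep hTident hT2 hT0) (memLp_norm_sq hQ)
    (memLp_norm_sq hQ).1 fun f => by positivity

variable [CompleteSpace H] (h0 : ∫ ω, Y ω ∂P = 0)
include h0

theorem tendsto_lintegral_scaledMean_mul_eLpNorm_sampleMean :
    Tendsto (fun n => ∫⁻ ω, ‖scaledMean Ys n ω‖ₑ
      * eLpNorm (fun f : H => 4 * ‖f‖ ^ 2 * ‖sampleMean n (Ys · ω)‖) 2 Q ∂P) atTop (𝓝 0) := by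
  have h2 : MemLp Y 2 P := h4.mono_exponent (by norm_num)
  exact tendsto_lintegral_mul_eLpNorm_mul_norm_sampleMean (ζ := fun _ => Ys) (ζ₀ := fun _ => Y)
    (fun _ => hindep) (fun _ => hident) (fun _ => h2) (fun _ => h0)
    (fun j => ((hident j).memLp_iff.2 h2).1.comp_fst)
    (lintegral_enorm_sq_ne_top h2) (fun _ => le_rfl)
    (fun n => (memLp_scaledMean hident h2 n).1.enorm) (lintegral_enorm_sq_ne_top h2)
    (lintegral_enorm_scaledMean_sq_le hindep hident h2 h0) ((memLp_norm_sq hQ).const_mul 4)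

theorem tendsto_lintegral_scaledMean_mul_eLpNorm_sinSubCosDeviation :
    Tendsto (fun n => ∫⁻ ω, ‖scaledMean Ys n ω‖ₑ
      * eLpNorm (fun f : H =>
        ‖f‖ * |sampleMean n (fun j => sinSubCosDeviation P Y f (Ys j ω))|) 2 Q ∂P)
      atTop (𝓝 0) := by
  have h2 : MemLp Y 2 P := h4.mono_exponent (by norm_num)
  have hjoint := measurable_uncurry_sinSubCosDeviation (P := P) (Y := Y) h2.1.aemeasurable
  have hdev (f : H) : Measurable (sinSubCosDeviation P Y f) := hjoint.of_uncurry_left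
  have hbound (f : H) : MemLp (fun ω => sinSubCosDeviation P Y f (Y ω)) ∞ P :=
    memLp_top_of_bound ((hdev f).comp_aemeasurable h2.1.aemeasurable).aestronglyMeasurable 4
      (.of_forall fun ω => abs_sinSubCosDeviation_le f (Y ω))
  refine tendsto_lintegral_mul_eLpNorm_mul_norm_sampleMean (C := 4 ^ 2)
    (ζ := fun f j ω => sinSubCosDeviation P Y f (Ys j ω))
    (ζ₀ := fun f ω => sinSubCosDeviation P Y f (Y ω))
    (fun f i j hij => (hindep hij).comp (hdev f) (hdev f)) (fun f j => (hident j).comp (hdev f))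
    (fun f => (hbound f).mono_exponent le_top)
    (integral_sinSubCosDeviation_eq_zero h2.1.aemeasurable) (fun j => ?_) (by finiteness)
    (fun f => ?_) (fun n => (memLp_scaledMean hident h2 n).1.enorm) (lintegral_enorm_sq_ne_top h2)
    (lintegral_enorm_scaledMean_sq_le hindep hident h2 h0)
    (hQ.norm.mono_exponent (by norm_num))
  · exact (hjoint.comp_aemeasurable (measurable_snd.aemeasurable.prodMk
      (hident j).aemeasurable_fst.comp_fst)).aestronglyMeasurable
  · refine (lintegral_mono (g := fun _ => 4 ^ 2) fun ω => ?_).trans (by simp)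
    exact pow_le_pow_left' (enorm_sinSubCosDeviation_le f (Y ω)) 2

theorem tendsto_lintegral_eLpNorm_linearizationRemainder :
    Tendsto (fun n : ℕ => ∫⁻ ω,
      eLpNorm (fun f => √(n : ℝ) * linearizationRemainder P Y n (Ys · ω) f) 2 Q ∂P)
      atTop (𝓝 0) := by
  have h2 : MemLp Y 2 P := h4.mono_exponent (by norm_num)
  have hscaled (n : ℕ) : AEMeasurable (fun ω => ‖scaledMean Ys n ω‖ₑ) P :=
    (memLp_scaledMean hident h2 n).1.enorm
  have hYs (j : ℕ) : AEStronglyMeasurable (fun p : Ω × H => Ys j p.1) (P.prod Q) :=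
    ((hident j).memLp_iff.2 h2).1.comp_fst
  have hdevs (j : ℕ) :
      AEStronglyMeasurable (fun p : Ω × H => sinSubCosDeviation P Y p.2 (Ys j p.1)) (P.prod Q) :=
    ((measurable_uncurry_sinSubCosDeviation h2.1.aemeasurable).comp_aemeasurable
      (measurable_snd.aemeasurable.prodMk (hYs j).aemeasurable)).aestronglyMeasurable
  have hmean (n : ℕ) : AEMeasurable (fun ω => ‖scaledMean Ys n ω‖ₑ
      * eLpNorm (fun f : H => 4 * ‖f‖ ^ 2 * ‖sampleMean n (Ys · ω)‖) 2 Q) P :=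
    (hscaled n).mul (aemeasurable_eLpNorm_two (((memLp_norm_sq hQ).const_mul 4).1.comp_snd.mul
      (aestronglyMeasurable_sampleMean hYs n).norm))
  have hdev (n : ℕ) : AEMeasurable (fun ω => ‖scaledMean Ys n ω‖ₑ * eLpNorm (fun f : H =>
      ‖f‖ * |sampleMean n (fun j => sinSubCosDeviation P Y f (Ys j ω))|) 2 Q) P :=
    (hscaled n).mul (aemeasurable_eLpNorm_two (hQ.1.norm.comp_snd.mul
      (aestronglyMeasurable_sampleMean hdevs n).norm))
  have hsum := ((tendsto_lintegral_scaledMean_mul_eLpNorm_sampleMean hindep hident h4 hQ h0).add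
    (tendsto_lintegral_scaledMean_mul_eLpNorm_sinSubCosDeviation hindep hident h4 hQ h0)).add
    (tendsto_lintegral_scaledMean_mul_eLpNorm_tensorSquareDeviation hindep hident h4 hQ)
  simp only [add_zero] at hsum
  refine tendsto_of_tendsto_of_tendsto_of_le_of_le tendsto_const_nhds hsum (fun _ => zero_le)
    fun n => ?_
  simp_rw [← lintegral_add_left' (hmean n)]
  refine (lintegral_mono fun ω =>
    eLpNorm_sqrt_mul_linearizationRemainder_le h4 h0 n (Ys · ω)).trans_eq ?_
  exact lintegral_add_left' ((hmean n).add (hdev n)) _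

end CentredSample

section RandomElements

open scoped Topology

theorem coeFn_sampleMean_toL2Q {S T : Type*} [MeasurableSpace T] {Q : Measure T} {F : S → T → ℝ}
    (hF : ∀ s, MemLp (F s) 2 Q) (n : ℕ) (y : ℕ → S) :
    (sampleMean n (fun j => toL2Q hF (y j)) : L2Q Q)
      =ᵐ[Q] fun f => sampleMean n fun j => F (y j) f := by
  have hclass : ∀ᵐ f ∂Q, ∀ j, toL2Q hF (y j) f = F (y j) f :=
    ae_all_iff.2 fun j => (hF (y j)).coeFn_toLp
  filter_upwards [Lp.coeFn_smul (n : ℝ)⁻¹ (∑ j ∈ Finset.range n, toL2Q hF (y j)),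
    Lp.coeFn_finsetSum (Finset.range n) fun j => toL2Q hF (y j), hclass] with f hsmul hsum hf
  rw [sampleMean, hsmul, Pi.smul_apply, hsum, Finset.sum_apply, sampleMean]
  simp only [hf]

variable {Ω : Type*} [MeasurableSpace Ω] {P : Measure Ω}
  {H : Type*} [NormedAddCommGroup H] [InnerProductSpace ℝ H] [MeasurableSpace H]
  {Y : Ω → H} {Ys : ℕ → Ω → H} {Q : Measure H}

theorem enorm_toL2Q_sub_sqrt_smul_sampleMean {n : ℕ}
    (hV : ∀ y : ℕ → H, MemLp (fun f => √(n : ℝ) * (VnStar n y f - zFun P Y f)) 2 Q)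
    (hξ : ∀ x, MemLp (fun f => xiFun P Y f x) 2 Q) (y : ℕ → H) :
    ‖toL2Q hV y - √(n : ℝ) • sampleMean n fun j => toL2Q hξ (y j)‖ₑ
      = eLpNorm (fun f => √(n : ℝ) * linearizationRemainder P Y n y f) 2 Q := by
  rw [Lp.enorm_def]
  refine eLpNorm_congr_ae ?_
  filter_upwards [Lp.coeFn_sub (toL2Q hV y) (√(n : ℝ) • sampleMean n fun j => toL2Q hξ (y j)),
    Lp.coeFn_smul (√(n : ℝ)) (sampleMean n fun j => toL2Q hξ (y j)),
    coeFn_sampleMean_toL2Q hξ n y, (hV y).coeFn_toLp] with f hsub hsmul hmean hf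
  rw [hsub, Pi.sub_apply, hsmul, Pi.smul_apply, hmean, toL2Q, hf, linearizationRemainder,
    smul_eq_mul, ← mul_sub]

variable [SecondCountableTopology H] [BorelSpace H] [IsFiniteMeasure Q] [CompleteSpace H]

section Paths

variable [IsProbabilityMeasure P] (h2 : MemLp Y 2 P) (h0 : ∫ ω, Y ω ∂P = 0)
include h2 h0

theorem measurable_toL2Q_xiFun (hξ : ∀ x, MemLp (fun f => xiFun P Y f x) 2 Q) :
    Measurable (toL2Q hξ) := by
  have hswap : Measurable (Prod.swap : H × H → H × H) := measurable_swap
  have hjoint := (measurable_uncurry_xiFun h2 h0).comp hswap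
  exact measurable_toL2Q hξ hjoint

theorem memLp_toL2Q_xiFun (h4 : MemLp Y 4 P) (hQ : MemLp id 4 Q)
    (hξ : ∀ x, MemLp (fun f => xiFun P Y f x) 2 Q) : MemLp (fun ω => toL2Q hξ (Y ω)) 2 P :=
  memLp_toL2Q (fun ω => hξ (Y ω))
    ((measurable_toL2Q_xiFun h2 h0 hξ).comp_aemeasurable h2.1.aemeasurable).aestronglyMeasurable
    (memLp_uncurry_xiFun h0 hQ h4)

theorem integral_toL2Q_xiFun (h4 : MemLp Y 4 P) (hQ : MemLp id 4 Q)
    (hξ : ∀ x, MemLp (fun f => xiFun P Y f x) 2 Q) : ∫ ω, toL2Q hξ (Y ω) ∂P = 0 :=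
  integral_toL2Q_eq_zero (fun ω => hξ (Y ω)) (memLp_toL2Q_xiFun h2 h0 h4 hQ hξ).1
    (memLp_uncurry_xiFun h0 hQ h4) (integral_xiFun_eq_zero h2 h0)

theorem measurable_uncurry_sqrt_mul_VnStar_sub_zFun (n : ℕ) :
    Measurable (Function.uncurry fun (y : ℕ → H) f => √(n : ℝ) * (VnStar n y f - zFun P Y f)) :=
  ((continuous_VnStar n).measurable.sub ((measurable_zFun h2 h0).comp measurable_snd)).const_mul _

theorem memLp_sqrt_mul_VnStar_sub_zFun (n : ℕ) (y : ℕ → H) :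
    MemLp (fun f => √(n : ℝ) * (VnStar n y f - zFun P Y f)) 2 Q := by
  have hmeas := (measurable_uncurry_sqrt_mul_VnStar_sub_zFun h2 h0 n).of_uncurry_left (x := y)
  refine .of_bound hmeas.aestronglyMeasurable (√(n : ℝ) * (3 + 3)) (.of_forall fun f => ?_)
  rw [norm_mul, Real.norm_of_nonneg (Real.sqrt_nonneg _)]
  gcongr
  exact (abs_sub _ _).trans (add_le_add (abs_VnStar_le n y f) (abs_zFun_le h2 h0 f))

end Paths

variable [IsProbabilityMeasure P] (hindep : iIndepFun Ys P)
  (hident : ∀ j, IdentDistrib (Ys j) Y P P) (h4 : MemLp Y 4 P) (h0 : ∫ ω, Y ω ∂P = 0)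
  (hQ : MemLp id 4 Q)
  (hV : ∀ (n : ℕ) y, MemLp (fun f => √(n : ℝ) * (VnStar n y f - zFun P Y f)) 2 Q)
  (hξ : ∀ x, MemLp (fun f => xiFun P Y f x) 2 Q)
include hident h4 h0

theorem aemeasurable_toL2Q_VnStar (n : ℕ) :
    AEMeasurable (fun ω => toL2Q (hV n) fun j => Ys j ω) P :=
  (measurable_toL2Q (hV n) (measurable_uncurry_sqrt_mul_VnStar_sub_zFun
    (h4.mono_exponent (by norm_num)) h0 n)).comp_aemeasurable
      (aemeasurable_pi_iff.2 fun j => (hident j).aemeasurable_fst)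

include hindep hQ

theorem tendstoInMeasure_toL2Q_VnStar_sub_scaledMean :
    TendstoInMeasure P ((fun n ω => toL2Q (hV n) fun j => Ys j ω)
      - scaledMean fun j ω => toL2Q hξ (Ys j ω)) atTop 0 := by
  have h2 : MemLp Y 2 P := h4.mono_exponent (by norm_num)
  have hξmeas := measurable_toL2Q_xiFun h2 h0 hξ
  have hlin (n : ℕ) := memLp_scaledMean (fun j => (hident j).comp hξmeas)
    (memLp_toL2Q_xiFun h2 h0 h4 hQ hξ) n
  refine tendstoInMeasure_of_tendsto_eLpNorm one_ne_zero (fun n => ?_)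
    aestronglyMeasurable_zero ?_
  · exact (aemeasurable_toL2Q_VnStar hident h4 h0 hV n).aestronglyMeasurable.sub (hlin n).1
  · simp_rw [sub_zero, eLpNorm_one_eq_lintegral_enorm]
    refine (tendsto_lintegral_eLpNorm_linearizationRemainder
      (fun i j hij => hindep.indepFun hij) hident h4 hQ h0).congr fun n => ?_
    congr 1 with ω
    exact (enorm_toL2Q_sub_sqrt_smul_sampleMean (hV n) hξ (Ys · ω)).symm

theorem exists_isCentredGaussianWithKernel_tendstoInDistribution :
    ∃ μ : ProbabilityMeasure (L2Q Q),
      IsCentredGaussianWithKernel Q (μ : Measure (L2Q Q)) id (kernelStar P Y) ∧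
      TendstoInDistribution (fun n ω => toL2Q (hV n) fun j => Ys j ω) atTop id (fun _ => P)
        (μ : Measure (L2Q Q)) := by
  have h2 : MemLp Y 2 P := h4.mono_exponent (by norm_num)
  have hξ := memLp_xiFun h2 h0 hQ
  have hξmeas := measurable_toL2Q_xiFun h2 h0 hξ
  have hξY2 := memLp_uncurry_xiFun h0 hQ h4
  have hζ2 := memLp_toL2Q_xiFun h2 h0 h4 hQ hξ
  have hζ0 := integral_toL2Q_xiFun h2 h0 h4 hQ hξ
  obtain ⟨μ, hgauss, hmean, hcov, hlim⟩ := exists_isGaussian_tendstoInDistribution_scaledMean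
    (hindep.comp (fun _ => toL2Q hξ) fun _ => hξmeas) (fun j => (hident j).comp hξmeas) hζ2 hζ0
  have hμ2 : MemLp (id : L2Q Q → L2Q Q) 2 (μ : Measure (L2Q Q)) :=
    IsGaussian.memLp_id _ 2 (by simp)
  refine ⟨μ, ⟨⟨by simpa using hgauss⟩, hmean, fun Φ Ψ => ?_, fun Φ Ψ => ?_, fun Φ Ψ => ?_⟩, ?_⟩
  · exact (hμ2.inner_const Φ).integrable_mul (hμ2.inner_const Ψ)
  · exact integrable_integral_mul_mul hξY2 Φ Ψ
  · calc ∫ v, ⟪v, Φ⟫ * ⟪v, Ψ⟫ ∂(μ : Measure (L2Q Q))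
        = covarianceBilin (μ : Measure (L2Q Q)) Φ Ψ := by
          simpa using (covarianceBilin_map_of_integral_eq_zero hμ2 hmean Φ Ψ).symm
      _ = ∫ ω, ⟪toL2Q hξ (Y ω), Φ⟫ * ⟪toL2Q hξ (Y ω), Ψ⟫ ∂P := by
          rw [hcov]
          exact covarianceBilin_map_of_integral_eq_zero hζ2 hζ0 Φ Ψ
      _ = ∫ p : H × H, kernelStar P Y p.1 p.2 * Φ p.1 * Ψ p.2 ∂(Q.prod Q) :=
          integral_inner_toL2Q_mul (fun ω => hξ (Y ω)) hξY2 Φ Ψ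
  · exact tendstoInDistribution_of_tendstoInMeasure_sub _ id hlim
      (tendstoInMeasure_toL2Q_VnStar_sub_scaledMean hindep hident h4 h0 hQ hV hξ)
      (aemeasurable_toL2Q_VnStar hident h4 h0 hV)

end RandomElements

theorem mainTheorem5
    {H : Type u} [NormedAddCommGroup H] [InnerProductSpace ℝ H] [CompleteSpace H]
    [SecondCountableTopology H] [MeasurableSpace H] [BorelSpace H]
    (Q : Measure H) [IsProbabilityMeasure Q]
    (hQ : Integrable (fun f : H => ‖f‖ ^ 4) Q)
    {Ω : Type v} [MeasurableSpace Ω] (P : Measure Ω) [IsProbabilityMeasure P]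
    (X : Ω → H) (Xs : ℕ → Ω → H)
    (hident : ∀ j, IdentDistrib (Xs j) X P P)
    (hindep : iIndepFun Xs P)
    (hX : Integrable (fun ω => ‖X ω‖ ^ 4) P)
    (Y : Ω → H) (hY : Y = fun ω => X ω - ∫ ω', X ω' ∂P) :
    ∃ (W : ℕ → Ω → L2Q Q)
      (Ω' : Type u) (_ : MeasurableSpace Ω') (P' : Measure Ω') (_ : IsProbabilityMeasure P')
      (V : Ω' → L2Q Q),
      (∀ n ω, W n ω =ᵐ[Q]
        fun f => √(n : ℝ) * (VnStar n (fun j => Xs j ω) f - zFun P Y f)) ∧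
      IsCentredGaussianWithKernel Q P' V (kernelStar P Y) ∧
      TendstoInDistribution W atTop V (fun _ => P) P' := by
  set c := ∫ ω', X ω' ∂P with hc
  have hQ4 : MemLp id 4 Q := memLp_natCast_of_integrable_norm_pow (by fun_prop) four_ne_zero hQ
  have hX4 : MemLp X 4 P := memLp_natCast_of_integrable_norm_pow
    (hident 0).aemeasurable_snd.aestronglyMeasurable four_ne_zero hX
  have h4 : MemLp Y 4 P := hY ▸ hX4.sub (memLp_const c)
  have h0 : ∫ ω, Y ω ∂P = 0 := by
    rw [hY, integral_sub (hX4.integrable (by norm_num)) (integrable_const c)]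
    simp [hc]
  have hidentY (j : ℕ) : IdentDistrib (fun ω => Xs j ω - c) Y P P :=
    hY ▸ (hident j).comp (u := fun x => x - c) (by fun_prop)
  have hindepY : iIndepFun (fun j ω => Xs j ω - c) P :=
    hindep.comp (fun _ x => x - c) fun _ => by fun_prop
  have hV := memLp_sqrt_mul_VnStar_sub_zFun (Q := Q) (h4.mono_exponent (by norm_num)) h0
  obtain ⟨μ, hgauss, hlim⟩ :=
    exists_isCentredGaussianWithKernel_tendstoInDistribution hindepY hidentY h4 h0 hQ4 hV
  refine ⟨fun n ω => toL2Q (hV n) fun j => Xs j ω - c, L2Q Q, inferInstance, μ, inferInstance, id,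
    fun n ω => ?_, hgauss, hlim⟩
  filter_upwards [(hV n fun j => Xs j ω - c).coeFn_toLp] with f hf
  rw [toL2Q, hf, VnStar_sub_const]
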